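/- All graphs are finite and simple. For a graph $G$, $\lambda(G)$ is its spectral radius, i.e. the largest eigenvalue of its adjacency matrix; $G$ is $H$-minor free if $H$ is not a minor of $G$; $P_k$ is the path on $k$ vertices; $\nabla$ denotes the join of graphs, $\cup$ the disjoint union, $pK_2$ the disjoint union of $p$ copies of $K_2$, and $\overline{K}_m$ the graph on $m$ vertices without edges. For $0\le t\le n$ put $$S_{n,t}=K_t\nabla\overline{K}_{n-t},\qquad F_{n,t}=K_t\nabla(pK_2\cup qK_1),\quad\text{where } n-t=2p+q,\ q\in\{0,1\}.$$ **Theorem.** Let $P_{k_1},\dots,P_{k_l}$ be pairwise vertex-disjoint paths in the complete graph $K_r$, on $k_1,\dots,k_l$ vertices respectively, and let $F=K_r-E(P_{k_1}\cup\dots\cup P_{k_l})$ be the graph obtained from $K_r$ by deleting their edges. (i) Suppose that $r\ge 4$, $l\ge 1$ and $k_1=\dots=k_l=2$ (a nonempty matching is deleted). Then there is an integer $N$, depending only on $F$, such that for every $n\ge N$ the graph $F_{n,r-3}$ is $F$-minor free, and every $F$-minor free graph $G$ on $n$ vertices satisfies $$\lambda(G)\le\lambda(F_{n,r-3}),$$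 with equality if and only if $G\cong F_{n,r-3}$. (ii) Suppose that $k_i\ge 3$ for at least one $i$ (so that $r\ge 3$). Then there is an integer $N$, depending only on $F$, such that for every $n\ge N$ the graph $S_{n,r-3}$ is $F$-minor free, and every $F$-minor free graph $G$ on $n$ vertices satisfies $$\lambda(G)\le\lambda(S_{n,r-3}),$$ with equality if and only if $G\cong S_{n,r-3}$. -/

import Mathlib

namespace MinorSpectral

/-- The join `G ∇ H`: the disjoint union of `G` and `H`, together with all edges between them. -/
def join {V W : Type*} (G : SimpleGraph V) (H : SimpleGraph W) : SimpleGraph (V ⊕ W) :=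
  (SimpleGraph.sum G H) ⊔ completeBipartiteGraph V W

/-- `H` is a minor of `G`: there are pairwise disjoint (nonempty) connected vertex sets of `G`,
one for each vertex of `H`, such that adjacent vertices of `H` have sets joined by an edge of `G`.
Contracting each of these sets and deleting what is superfluous yields `H`. -/
def IsMinor {W V : Type*} (H : SimpleGraph W) (G : SimpleGraph V) : Prop :=
  ∃ B : W → Set V,
    (∀ w, (G.induce (B w)).Connected) ∧
    (∀ u v, u ≠ v → Disjoint (B u) (B v)) ∧
    (∀ u v, H.Adj u v → ∃ x ∈ B u, ∃ y ∈ B v, G.Adj x y)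

/-- `G` is `H`-minor free. -/
def MinorFree {W V : Type*} (H : SimpleGraph W) (G : SimpleGraph V) : Prop :=
  ¬ IsMinor H G

open scoped Classical in
/-- The spectral radius of a finite graph: the largest eigenvalue of its adjacency matrix. -/
noncomputable def lam {V : Type*} [Fintype V] (G : SimpleGraph V) : ℝ :=
  sSup (spectrum ℝ (G.adjMatrix ℝ))

open scoped Classical in
/-- For a nonempty graph, `lam G` is indeed the largest eigenvalue of the adjacency matrix. -/
theorem lam_isGreatest {V : Type*} [Fintype V] [Nonempty V] (G : SimpleGraph V) :
    IsGreatest (spectrum ℝ (G.adjMatrix ℝ)) (lam G) := by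
  have hne : (spectrum ℝ (G.adjMatrix ℝ)).Nonempty :=
    ⟨_, (G.isHermitian_adjMatrix ℝ).eigenvalues_mem_spectrum_real (Classical.arbitrary V)⟩
  have hfin : (spectrum ℝ (G.adjMatrix ℝ)).Finite := Matrix.finite_real_spectrum
  exact ⟨hne.csSup_mem hfin, fun _ hx => le_csSup hfin.bddAbove hx⟩

/-- `S_{n,t} = K_t ∇ (complement of K_{n-t})`, for `t ≤ n`. -/
def splitGraph (n t : ℕ) : SimpleGraph (Fin t ⊕ Fin (n - t)) :=
  join (⊤ : SimpleGraph (Fin t)) (⊥ : SimpleGraph (Fin (n - t)))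

/-- `p K_2 ∪ q K_1`: the vertices `(i, 0)` and `(i, 1)` are adjacent for each `i`, and there are
`q` further isolated vertices. -/
def edgesAndPoints (p q : ℕ) : SimpleGraph ((Fin p × Fin 2) ⊕ Fin q) :=
  SimpleGraph.sum
    (SimpleGraph.boxProd (⊥ : SimpleGraph (Fin p)) (⊤ : SimpleGraph (Fin 2)))
    (⊥ : SimpleGraph (Fin q))

/-- `F_{n,t} = K_t ∇ (p K_2 ∪ q K_1)` with `n - t = 2 p + q` and `q ∈ {0, 1}`, for `t ≤ n`. -/
def friendshipGraph (n t : ℕ) :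
    SimpleGraph (Fin t ⊕ ((Fin ((n - t) / 2) × Fin 2) ⊕ Fin ((n - t) % 2))) :=
  join (⊤ : SimpleGraph (Fin t)) (edgesAndPoints ((n - t) / 2) ((n - t) % 2))

/-- `K_r - E(P_{k_1} ∪ ⋯ ∪ P_{k_l})`. The injective map `φ` places the `l` paths, the `i`-th one on
`k i` vertices, vertex-disjointly in `K_r`: the `j`-th vertex of the `i`-th path is `φ ⟨i, j⟩`. -/
def completeMinusPaths (r : ℕ) {l : ℕ} (k : Fin l → ℕ) (φ : (Σ i, Fin (k i)) ↪ Fin r) :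
    SimpleGraph (Fin r) :=
  (⊤ : SimpleGraph (Fin r)) \
    ⨆ i, (SimpleGraph.pathGraph (k i)).map ((Function.Embedding.sigmaMk i).trans φ)

end MinorSpectral

namespace MinorSpectral

/-! ### Spectral radius: Rayleigh quotients and a nonnegative eigenvector -/

section Spectral

open scoped Classical
open Matrix Finset

variable {V W : Type*} [Fintype V] [Fintype W]

/-! Put `t = r - 3`. The target graphs have no `F`-minor: `K_t` meets at most `t` branch sets, so
three of them lie in the remaining edgeless graph or matching. But three vertices of `F` always span
an edge, since a path has no triangle, and they span a two-edge path when only a matching was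
deleted.

For the bound let `t ≥ 1` (for `t = 0` a large `F`-minor free graph has no edges at all), and let
`G` be `F`-minor free with spectral radius at least that of the target, so that `λ² ≥ t(n - t)`.
Excluding the minor makes every subgraph sparse (`degSum_le_of_minorFree`, by Mader's contraction
argument) and excludes `K_{t+1,t+4}` (`card_common_le`). Counting two-step walks against an
eigenvector `x` with maximum `1` then shows that exactly `t` vertices, the set `T`, have weight at
least `1/2`, that all others have small weight, and that at least half of all vertices are adjacent
to the whole of `T` (`exists_heavy_set`).

Let `R` be the set of common neighbours of `T`. Since `T` and `R` supply all but three branch sets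
of `F` (`isMinor_of_join`), `R` spans only a matching, or no edge if some deleted path has at least
three vertices, and a vertex outside `T` has at most two neighbours in `R`. So the target can be
laid on the vertices of `G` with `T` dominating and with all edges of `G` inside `R`. Comparing the
quadratic forms of both graphs at `x` forces equality (`eq_of_heavy_set`): a vertex outside `T ∪ R`
gains an edge to a heavy vertex and loses only edges to light ones. -/

theorem lam_congr {G : SimpleGraph V} {H : SimpleGraph W} (e : G ≃g H) : lam G = lam H := by
  have h : reindexAlgEquiv ℝ ℝ e.toEquiv (G.adjMatrix ℝ) = H.adjMatrix ℝ :=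
    SimpleGraph.Iso.reindex_adjMatrix ℝ e
  unfold lam
  rw [← h]
  congr 1
  convert (AlgEquiv.spectrum_eq (reindexAlgEquiv ℝ ℝ e.toEquiv) (G.adjMatrix ℝ)).symm

theorem posSemidef_lam_sub (G : SimpleGraph V) :
    (algebraMap ℝ (Matrix V V ℝ) (lam G) - G.adjMatrix ℝ).PosSemidef := by
  rcases isEmpty_or_nonempty V with hV | hV
  · convert PosSemidef.zero (n := V) (R := ℝ)
    exact Subsingleton.elim _ _
  rw [posSemidef_iff_isHermitian_and_spectrum_nonneg]
  constructor
  · refine IsHermitian.sub ?_ (G.isHermitian_adjMatrix ℝ)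
    rw [algebraMap_eq_diagonal]
    exact isHermitian_diagonal _
  · rw [← spectrum.singleton_sub_eq]
    rintro _ ⟨_, rfl, b, hb, rfl⟩
    exact sub_nonneg.2 ((lam_isGreatest G).2 hb)

theorem dotProduct_lam_sub_mulVec (G : SimpleGraph V) (x : V → ℝ) :
    star x ⬝ᵥ (algebraMap ℝ (Matrix V V ℝ) (lam G) - G.adjMatrix ℝ) *ᵥ x =
      lam G * ∑ u, x u ^ 2 - ∑ u, ∑ v, if G.Adj u v then x u * x v else 0 := by
  rw [star_trivial, sub_mulVec, dotProduct_sub, G.dotProduct_mulVec_adjMatrix,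
    algebraMap_eq_diagonal]
  congr 1
  simp only [dotProduct, mulVec_diagonal, mul_sum, Pi.algebraMap_apply, Algebra.algebraMap_self,
    RingHom.id_apply]
  exact sum_congr rfl fun u _ => by ring

theorem quadForm_le_lam (G : SimpleGraph V) (x : V → ℝ) :
    (∑ u, ∑ v, if G.Adj u v then x u * x v else 0) ≤ lam G * ∑ u, x u ^ 2 := by
  have h := (posSemidef_lam_sub G).dotProduct_mulVec_nonneg x
  rw [dotProduct_lam_sub_mulVec] at h
  linarith

/-- The matrix `λI - A` is positive semidefinite, so a vector on which its form vanishes lies in its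
kernel. -/
theorem eigenvector_of_quadForm_eq (G : SimpleGraph V) (x : V → ℝ)
    (h : (∑ u, ∑ v, if G.Adj u v then x u * x v else 0) = lam G * ∑ u, x u ^ 2) (u : V) :
    ∑ v with G.Adj u v, x v = lam G * x u := by
  have h0 := ((posSemidef_lam_sub G).dotProduct_mulVec_zero_iff x).1
    (by rw [dotProduct_lam_sub_mulVec, h, sub_self])
  have h1 := congrFun h0 u
  rw [sub_mulVec, Pi.sub_apply, algebraMap_eq_diagonal, mulVec_diagonal,
    G.adjMatrix_mulVec_apply] at h1
  simp only [Pi.algebraMap_apply, Algebra.algebraMap_self, RingHom.id_apply, Pi.zero_apply,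
    SimpleGraph.neighborFinset_eq_filter] at h1
  linarith

theorem exists_quadForm_eq [Nonempty V] (G : SimpleGraph V) :
    ∃ y : V → ℝ, y ≠ 0 ∧
      (∑ u, ∑ v, if G.Adj u v then y u * y v else 0) = lam G * ∑ u, y u ^ 2 := by
  have h := (lam_isGreatest G).1
  rw [← spectrum_toLin', ← Module.End.hasEigenvalue_iff_mem_spectrum] at h
  obtain ⟨y, hy⟩ := h.exists_hasEigenvector
  refine ⟨y, hy.2, ?_⟩
  have h1 := hy.apply_eq_smul
  rw [toLin'_apply] at h1
  rw [← G.dotProduct_mulVec_adjMatrix, h1, dotProduct_smul, smul_eq_mul]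
  simp [dotProduct, sq]

/-- A nonnegative eigenvector for the spectral radius, with largest entry `1`. -/
theorem exists_perron [Nonempty V] (G : SimpleGraph V) :
    ∃ x : V → ℝ, (∀ u, 0 ≤ x u) ∧ (∀ u, x u ≤ 1) ∧ (∃ u, x u = 1) ∧
      (∀ u, ∑ v with G.Adj u v, x v = lam G * x u) ∧
      (∑ u, ∑ v, if G.Adj u v then x u * x v else 0) = lam G * ∑ u, x u ^ 2 := by
  obtain ⟨y, hy0, hy⟩ := exists_quadForm_eq G
  obtain ⟨m, -, hm⟩ := exists_max_image univ (fun u => |y u|) univ_nonempty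
  have hpos : 0 < |y m| := by
    obtain ⟨u, hu⟩ := Function.ne_iff.1 hy0
    exact (abs_pos.2 hu).trans_le (hm u (mem_univ _))
  -- Taking absolute values does not decrease the form and preserves the norm, so the maximum of the
  -- Rayleigh quotient is still attained.
  have key : (∑ u, ∑ v, if G.Adj u v then (|y u| / |y m|) * (|y v| / |y m|) else 0) =
      lam G * ∑ u, (|y u| / |y m|) ^ 2 := by
    refine le_antisymm (quadForm_le_lam G fun u => |y u| / |y m|) ?_
    have e1 : ∑ u, (|y u| / |y m|) ^ 2 = (∑ u, y u ^ 2) / |y m| ^ 2 := by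
      simp only [sum_div, div_pow, sq_abs]
    rw [e1, mul_div_assoc', ← hy, sum_div]
    refine sum_le_sum fun u _ => ?_
    rw [sum_div]
    refine sum_le_sum fun v _ => ?_
    split_ifs
    · rw [div_mul_div_comm, ← sq, ← abs_mul]
      gcongr
      exact le_abs_self _
    · simp
  refine ⟨fun u => |y u| / |y m|, fun u => by positivity,
    fun u => (div_le_one hpos).2 (hm u (mem_univ _)), ⟨m, div_self hpos.ne'⟩,
    eigenvector_of_quadForm_eq G _ key, key⟩

theorem lam_nonneg [Nonempty V] (G : SimpleGraph V) : 0 ≤ lam G := by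
  obtain ⟨x, hx0, -, ⟨m, hm⟩, heig, -⟩ := exists_perron G
  rw [← mul_one (lam G), ← hm, ← heig]
  exact sum_nonneg fun _ _ => hx0 _

theorem sum_sum_erase {U R : Type*} [CommSemiring R] (S : Finset U) (a : U → U → R)
    (hs : ∀ u v, a u v = a v u) (h0 : ∀ u, a u u = 0) {w : U} (hw : w ∈ S) :
    ∑ u ∈ S, ∑ v ∈ S, a u v =
      ∑ u ∈ S.erase w, ∑ v ∈ S.erase w, a u v + 2 * ∑ v ∈ S, a w v := by
  have h1 : ∀ u, ∑ v ∈ S, a u v = a u w + ∑ v ∈ S.erase w, a u v := fun u =>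
    (add_sum_erase S (a u) hw).symm
  rw [← add_sum_erase S _ hw]
  simp only [h1, sum_add_distrib, h0, zero_add, fun u => hs u w]
  ring

theorem adj_eq_of_quadForm_eq {G H : SimpleGraph V} (hle : G ≤ H) (x : V → ℝ)
    (hx : ∀ u, 0 < x u)
    (h : (∑ u, ∑ v, if H.Adj u v then x u * x v else 0) ≤
      ∑ u, ∑ v, if G.Adj u v then x u * x v else 0) : G = H := by
  have hp : ∀ u v, (if G.Adj u v then x u * x v else 0) ≤ if H.Adj u v then x u * x v else 0 := by
    intro u v
    split_ifs with h1 h2 h2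
    · exact le_rfl
    · exact absurd (hle h1) h2
    · exact (mul_pos (hx u) (hx v)).le
    · exact le_rfl
  refine le_antisymm hle fun u v huv => ?_
  by_contra hn
  refine absurd h (not_le.2 ?_)
  refine sum_lt_sum (fun a _ => sum_le_sum fun b _ => hp a b) ⟨u, mem_univ _, ?_⟩
  refine sum_lt_sum (fun b _ => hp u b) ⟨v, mem_univ _, ?_⟩
  rw [if_neg hn, if_pos huv]
  exact mul_pos (hx u) (hx v)

end Spectral

/-! ### Sparsity of minor free graphs, and minors built on common neighbours -/

section Minors

open scoped Classical
open Finset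

/-- Twice the number of edges inside `S`. -/
noncomputable def degSum {V : Type*} (G : SimpleGraph V) (S : Finset V) : ℕ :=
  ∑ u ∈ S, #{v ∈ S | G.Adj u v}

theorem degSum_erase {V : Type*} (G : SimpleGraph V) (S : Finset V) {w : V} (hw : w ∈ S) :
    degSum G S = degSum G (S.erase w) + 2 * #{v ∈ S | G.Adj w v} := by
  simp only [degSum, card_filter]
  exact sum_sum_erase S (fun u v => if G.Adj u v then 1 else 0)
    (fun u v => by simp [G.adj_comm]) (fun u => by simp) hw

theorem connected_induce_insert {V : Type*} {G : SimpleGraph V} {U : Set V} {u w : V}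
    (hU : (G.induce U).Connected) (hu : u ∈ U) (huw : G.Adj u w) :
    (G.induce (insert w U)).Connected := by
  rw [← Set.union_singleton]
  exact SimpleGraph.connected_induce_union hU.preconnected
    (by rw [SimpleGraph.induce_singleton_eq_top]; exact SimpleGraph.preconnected_top) hu rfl huw

theorem connected_induce_singleton {V : Type*} (G : SimpleGraph V) (v : V) :
    (G.induce ({v} : Set V)).Connected := by
  rw [SimpleGraph.induce_singleton_eq_top]
  exact SimpleGraph.connected_top

/-- A finite set spanning at least `2 ^ (r - 1)` times as many edges as it has vertices
contains a complete minor of order `r + 1`. -/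
theorem exists_clique_minor {V : Type*} (G : SimpleGraph V) (r : ℕ) (S : Finset V)
    (hS : S.Nonempty) (h : 2 ^ r * #S ≤ degSum G S) :
    ∃ B : Fin (r + 1) → Finset V, (∀ w, B w ⊆ S) ∧ (∀ w, (G.induce (B w : Set V)).Connected) ∧
      (∀ u v, u ≠ v → Disjoint (B u) (B v)) ∧
      ∀ u v, u ≠ v → ∃ x ∈ B u, ∃ y ∈ B v, G.Adj x y := by
  induction r generalizing S with
  | zero =>
    obtain ⟨v, hv⟩ := hS
    refine ⟨fun _ => {v}, fun _ => by simpa using hv, fun _ => ?_,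
      fun u w huw => absurd (Fin.subsingleton_one.elim u w) huw,
      fun u w huw => absurd (Fin.subsingleton_one.elim u w) huw⟩
    rw [coe_singleton]
    exact connected_induce_singleton G v
  | succ r ihr =>
    induction S using Finset.strongInduction with
    | H S ihS =>
    -- Contracting `U` to a point leaves `#(S \ U) + 1` vertices and degree sum `degSum G (S \ U) +
    -- 2 * #(N U)`. Thus `good U` says that the density hypothesis survives the contraction; a
    -- largest such `U` is taken.
    let N : Finset V → Finset V := fun U => {w ∈ S \ U | ∃ u ∈ U, G.Adj u w}
    let good : Finset V → Prop := fun U => (G.induce (U : Set V)).Connected ∧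
      2 ^ (r + 1) * (#(S \ U) + 1) ≤ degSum G (S \ U) + 2 * #(N U)
    obtain ⟨v, hv⟩ := hS
    have hgv : good {v} := by
      refine ⟨by rw [coe_singleton]; exact connected_induce_singleton G v, ?_⟩
      rw [sdiff_singleton_eq_erase, card_erase_add_one hv]
      rw [degSum_erase G S hv] at h
      have e : N {v} = {w ∈ S | G.Adj v w} := by
        ext w
        simp only [N, mem_filter, mem_sdiff, mem_singleton, exists_eq_left]
        exact ⟨fun hw => ⟨hw.1.1, hw.2⟩, fun hw => ⟨⟨hw.1, hw.2.ne'⟩, hw.2⟩⟩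
      rw [e]
      exact h
    obtain ⟨U, hU, hmax⟩ := exists_max_image (S.powerset.filter good) card
      ⟨{v}, by simp [hv, hgv]⟩
    rw [mem_filter, mem_powerset] at hU
    obtain ⟨hUS, hUc, hUg⟩ := hU
    have hUne : U.Nonempty := by
      obtain ⟨x⟩ := hUc.nonempty
      exact ⟨x, x.2⟩
    -- If nothing is adjacent to `U`, the rest is still dense and the induction on `S` applies. It
    -- is nonempty, as `good` would otherwise read `2 ^ (r + 1) ≤ 0`.
    rcases (N U).eq_empty_or_nonempty with hN | hN
    · rw [hN, card_empty, mul_zero, add_zero] at hUg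
      have hlt : S \ U ⊂ S := sdiff_ssubset hUS hUne
      have hne : (S \ U).Nonempty := by
        by_contra hcon
        rw [not_nonempty_iff_eq_empty] at hcon
        rw [hcon] at hUg
        simp [degSum] at hUg
      obtain ⟨B, hB, hB'⟩ := ihS _ hlt hne
        ((Nat.mul_le_mul_left _ (Nat.le_succ _)).trans hUg)
      exact ⟨B, fun w => (hB w).trans sdiff_subset, hB'⟩
    -- By maximality, absorbing `w` into `U` destroys the density. This costs one vertex, the edge
    -- from `U` to `w`, and one edge for each common neighbour of `U` and `w`, so there are at least
    -- `2 ^ r` of the latter. Hence `N U` is dense enough for a clique minor of order `r + 1`, to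
    -- which `U` is added.
    · have hdeg : ∀ w ∈ N U, 2 ^ r ≤ #{v ∈ N U | G.Adj w v} := by
        intro w hw
        have hw' := hw
        simp only [N, mem_filter, mem_sdiff] at hw'
        obtain ⟨⟨hwS, hwU⟩, u, huU, huw⟩ := hw'
        have hnot : ¬ good (insert w U) := by
          intro hg
          have := hmax (insert w U) (by
            rw [mem_filter, mem_powerset, insert_subset_iff]
            exact ⟨⟨hwS, hUS⟩, hg⟩)
          rw [card_insert_of_notMem hwU] at this
          omega
        have hlt : degSum G ((S \ U).erase w) + 2 * #(N (insert w U)) <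
            2 ^ (r + 1) * (#((S \ U).erase w) + 1) := by
          by_contra hcon
          refine hnot ⟨?_, ?_⟩
          · rw [coe_insert]
            exact connected_induce_insert hUc huU huw
          · rw [sdiff_insert]
            exact not_lt.1 hcon
        have hwSU : w ∈ S \ U := mem_sdiff.2 ⟨hwS, hwU⟩
        rw [card_erase_add_one hwSU] at hlt
        rw [degSum_erase G _ hwSU] at hUg
        have hsub : (N U).erase w ∪ ({v ∈ S \ U | G.Adj w v} \ {v ∈ N U | G.Adj w v}) ⊆
            N (insert w U) := by
          intro z hz
          simp only [N, mem_union, mem_erase, mem_filter, mem_sdiff, mem_insert] at hz ⊢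
          rcases hz with ⟨hzw, ⟨hzS, hzU⟩, a, ha, haz⟩ | ⟨⟨⟨hzS, hzU⟩, hwz⟩, -⟩
          · exact ⟨⟨hzS, by tauto⟩, a, Or.inr ha, haz⟩
          · refine ⟨⟨hzS, ?_⟩, w, Or.inl rfl, hwz⟩
            rintro (rfl | hh)
            · exact hwz.ne rfl
            · exact hzU hh
        have hdisj : Disjoint ((N U).erase w)
            ({v ∈ S \ U | G.Adj w v} \ {v ∈ N U | G.Adj w v}) := by
          rw [Finset.disjoint_left]
          intro z hz hz'
          simp only [mem_sdiff, mem_filter, mem_erase] at hz hz'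
          exact hz'.2 ⟨hz.2, hz'.1.2⟩
        have hc1 := card_le_card hsub
        rw [card_union_of_disjoint hdisj] at hc1
        have hc2 := le_card_sdiff {v ∈ N U | G.Adj w v} {v ∈ S \ U | G.Adj w v}
        have hc3 := card_erase_add_one hw
        rw [mul_add, mul_one, pow_succ] at hUg
        rw [pow_succ] at hlt
        omega
      obtain ⟨B, hBS, hBc, hBd, hBa⟩ := ihr (N U) hN (by
        unfold degSum
        calc 2 ^ r * #(N U) = ∑ w ∈ N U, 2 ^ r := by rw [sum_const, smul_eq_mul, mul_comm]
          _ ≤ _ := sum_le_sum hdeg)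
      have hNU : N U ⊆ S \ U := filter_subset _ _
      have hadj : ∀ w, ∃ x ∈ U, ∃ y ∈ B w, G.Adj x y := by
        intro w
        obtain ⟨y⟩ := (hBc w).nonempty
        have hy := hBS w y.2
        simp only [N, mem_filter] at hy
        obtain ⟨-, u, hu, huy⟩ := hy
        exact ⟨u, hu, y, y.2, huy⟩
      have hdis : ∀ w, Disjoint U (B w) := fun w =>
        (disjoint_sdiff).mono_right ((hBS w).trans hNU)
      refine ⟨Fin.cons U B, ?_, ?_, ?_, ?_⟩
      · intro w
        refine Fin.cases ?_ (fun i => ?_) w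
        · exact hUS
        · exact (hBS i).trans (hNU.trans sdiff_subset)
      · intro w
        refine Fin.cases ?_ (fun i => ?_) w
        · exact hUc
        · exact hBc i
      · intro a b
        refine Fin.cases ?_ (fun i => ?_) a <;> refine Fin.cases ?_ (fun j => ?_) b
        · exact fun hh => absurd rfl hh
        · exact fun _ => hdis j
        · exact fun _ => (hdis i).symm
        · exact fun hh => hBd i j fun e => hh (by rw [e])
      · intro a b
        refine Fin.cases ?_ (fun i => ?_) a <;> refine Fin.cases ?_ (fun j => ?_) b
        · exact fun hh => absurd rfl hh
        · exact fun _ => hadj j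
        · intro _
          obtain ⟨x, hx, y, hy, hxy⟩ := hadj i
          exact ⟨y, hy, x, hx, hxy.symm⟩
        · exact fun hh => hBa i j fun e => hh (by rw [e])

theorem degSum_le_of_minorFree {V : Type*} {r : ℕ} {F : SimpleGraph (Fin r)} {G : SimpleGraph V}
    (hF : MinorFree F G) (S : Finset V) : degSum G S ≤ 2 ^ r * #S := by
  rcases S.eq_empty_or_nonempty with rfl | hS
  · simp [degSum]
  by_contra hcon
  obtain ⟨B, -, hBc, hBd, hBa⟩ := exists_clique_minor G r S hS (not_le.1 hcon).le
  refine hF ⟨fun w => B w.castSucc, fun w => hBc _, fun u v huv => ?_, fun u v huv => ?_⟩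
  · exact disjoint_coe.2 (hBd _ _ fun e => huv (Fin.castSucc_injective _ e))
  · exact hBa _ _ fun e => huv.ne (Fin.castSucc_injective _ e)

/-- Each vertex of `F` other than `a, b, c` receives a pair consisting of one vertex of `T` and one
of `R`. Such a pair is connected, and its `T`-vertex is adjacent to every branch set that meets `R`,
which all of them do; `T` need not be a clique. Only the adjacencies among `a, b, c` remain to be
supplied. -/
theorem isMinor_of_join {V : Type*} {t : ℕ} {F : SimpleGraph (Fin (t + 3))} {G : SimpleGraph V}
    {a b c : Fin (t + 3)} (hab : a ≠ b) (hac : a ≠ c) (hbc : b ≠ c)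
    {T R Ba Bb Bc : Finset V} (hT : #T = t) (hR : ∀ x ∈ R, ∀ v ∈ T, G.Adj x v)
    (hcard : t ≤ #(R \ (Ba ∪ Bb ∪ Bc)))
    (ha : (G.induce (Ba : Set V)).Connected) (hb : (G.induce (Bb : Set V)).Connected)
    (hc : (G.induce (Bc : Set V)).Connected)
    (dab : Disjoint Ba Bb) (dac : Disjoint Ba Bc) (dbc : Disjoint Bb Bc)
    (dT : Disjoint T (Ba ∪ Bb ∪ Bc))
    (Ra : ∃ x ∈ Ba, x ∈ R) (Rb : ∃ x ∈ Bb, x ∈ R) (Rc : ∃ x ∈ Bc, x ∈ R)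
    (eab : F.Adj a b → ∃ x ∈ Ba, ∃ y ∈ Bb, G.Adj x y)
    (eac : F.Adj a c → ∃ x ∈ Ba, ∃ y ∈ Bc, G.Adj x y)
    (ebc : F.Adj b c → ∃ x ∈ Bb, ∃ y ∈ Bc, G.Adj x y) : IsMinor F G := by
  have hcw : Fintype.card {w : Fin (t + 3) // w ∉ ({a, b, c} : Finset (Fin (t + 3)))} = t := by
    rw [Fintype.card_subtype_compl, Fintype.card_fin, Fintype.card_coe,
      card_eq_three.2 ⟨a, b, c, hab, hac, hbc, rfl⟩]
    rfl
  obtain ⟨f⟩ : Nonempty ({w : Fin (t + 3) // w ∉ ({a, b, c} : Finset (Fin (t + 3)))} ↪ T) :=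
    Function.Embedding.nonempty_of_card_le (by rw [hcw, Fintype.card_coe, hT])
  obtain ⟨g⟩ : Nonempty ({w : Fin (t + 3) // w ∉ ({a, b, c} : Finset (Fin (t + 3)))} ↪
      ↥(R \ (Ba ∪ Bb ∪ Bc))) :=
    Function.Embedding.nonempty_of_card_le (by rw [hcw, Fintype.card_coe]; exact hcard)
  have hTR : ∀ v ∈ T, v ∉ R := fun v hv hv' => (hR v hv' v hv).ne rfl
  let B : Fin (t + 3) → Finset V := fun w =>
    if w = a then Ba else if w = b then Bb else if w = c then Bc else
      if h : w ∉ ({a, b, c} : Finset (Fin (t + 3))) then {(f ⟨w, h⟩ : V), (g ⟨w, h⟩ : V)} else ∅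
  have Ba' : B a = Ba := if_pos rfl
  have Bb' : B b = Bb := by simp [B, hab.symm]
  have Bc' : B c = Bc := by simp [B, hac.symm, hbc.symm]
  have Bo : ∀ w, (h : w ∉ ({a, b, c} : Finset (Fin (t + 3)))) →
      B w = {(f ⟨w, h⟩ : V), (g ⟨w, h⟩ : V)} := by
    intro w h
    have h' := h
    simp only [mem_insert, mem_singleton, not_or] at h'
    simp only [B]
    rw [if_neg h'.1, if_neg h'.2.1, if_neg h'.2.2, dif_pos h]
  have hgR : ∀ w, (g w : V) ∈ R := fun w => (mem_sdiff.1 (g w).2).1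
  have hcore : ∀ w ∈ ({a, b, c} : Finset (Fin (t + 3))),
      B w ⊆ Ba ∪ Bb ∪ Bc ∧ ∃ x ∈ B w, x ∈ R := by
    intro w hw
    simp only [mem_insert, mem_singleton] at hw
    rcases hw with rfl | rfl | rfl
    · rw [Ba']
      exact ⟨subset_union_left.trans subset_union_left, Ra⟩
    · rw [Bb']
      exact ⟨subset_union_right.trans subset_union_left, Rb⟩
    · rw [Bc']
      exact ⟨subset_union_right, Rc⟩
  have hmeet : ∀ w, ∃ x ∈ B w, x ∈ R := by
    intro w
    by_cases h : w ∈ ({a, b, c} : Finset (Fin (t + 3)))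
    · exact (hcore w h).2
    · exact ⟨g ⟨w, h⟩, by rw [Bo w h]; simp, hgR _⟩
  have hdis1 : ∀ u v, u ∉ ({a, b, c} : Finset (Fin (t + 3))) →
      v ∈ ({a, b, c} : Finset (Fin (t + 3))) → Disjoint (B u) (B v) := by
    intro u v hu hv
    refine Disjoint.mono_right (hcore v hv).1 ?_
    rw [Bo u hu, Finset.disjoint_left]
    intro x hx
    simp only [mem_insert, mem_singleton] at hx
    rcases hx with rfl | rfl
    · exact Finset.disjoint_left.1 dT (f _).2
    · exact (mem_sdiff.1 (g _).2).2
  have hadj1 : ∀ u v, u ∉ ({a, b, c} : Finset (Fin (t + 3))) →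
      ∃ x ∈ B u, ∃ y ∈ B v, G.Adj x y := by
    intro u v hu
    obtain ⟨y, hy, hyR⟩ := hmeet v
    exact ⟨f ⟨u, hu⟩, by rw [Bo u hu]; simp, y, hy, (hR y hyR _ (f _).2).symm⟩
  refine ⟨fun w => B w, fun w => ?_, fun u v huv => disjoint_coe.2 ?_, fun u v huv => ?_⟩
  · beta_reduce
    by_cases h : w ∈ ({a, b, c} : Finset (Fin (t + 3)))
    · simp only [mem_insert, mem_singleton] at h
      rcases h with rfl | rfl | rfl
      · rwa [Ba']
      · rwa [Bb']
      · rwa [Bc']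
    · rw [Bo w h, coe_insert, coe_singleton]
      exact SimpleGraph.induce_pair_connected_of_adj (hR _ (hgR _) _ (f _).2).symm
  · by_cases hu : u ∈ ({a, b, c} : Finset (Fin (t + 3))) <;>
      by_cases hv : v ∈ ({a, b, c} : Finset (Fin (t + 3)))
    · simp only [mem_insert, mem_singleton] at hu hv
      rcases hu with rfl | rfl | rfl <;> rcases hv with rfl | rfl | rfl <;>
        first
          | exact absurd rfl huv
          | (simp only [Ba', Bb', Bc']; assumption)
          | (simp only [Ba', Bb', Bc']; rw [disjoint_comm]; assumption)
    · exact (hdis1 v u hv hu).symm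
    · exact hdis1 u v hu hv
    · rw [Bo u hu, Bo v hv, Finset.disjoint_left]
      have h1 : (f ⟨u, hu⟩ : V) ≠ f ⟨v, hv⟩ := fun e =>
        huv (congrArg Subtype.val (f.injective (Subtype.ext e)))
      have h2 : (g ⟨u, hu⟩ : V) ≠ g ⟨v, hv⟩ := fun e =>
        huv (congrArg Subtype.val (g.injective (Subtype.ext e)))
      have h3 : ∀ p q, (f p : V) ≠ g q := fun p q e => hTR _ (f p).2 (e ▸ hgR q)
      intro x hx hx'
      simp only [mem_insert, mem_singleton] at hx hx'
      rcases hx with rfl | rfl <;> rcases hx' with hx' | hx'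
      · exact h1 hx'
      · exact h3 _ _ hx'
      · exact h3 _ _ hx'.symm
      · exact h2 hx'
  · by_cases hu : u ∈ ({a, b, c} : Finset (Fin (t + 3)))
    · by_cases hv : v ∈ ({a, b, c} : Finset (Fin (t + 3)))
      · have sw : ∀ {X Y : Finset V}, (∃ x ∈ X, ∃ y ∈ Y, G.Adj x y) →
            ∃ x ∈ Y, ∃ y ∈ X, G.Adj x y := fun ⟨x, hx, y, hy, h⟩ => ⟨y, hy, x, hx, h.symm⟩
        simp only [mem_insert, mem_singleton] at hu hv
        rcases hu with rfl | rfl | rfl <;> rcases hv with rfl | rfl | rfl <;>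
          first
            | exact absurd rfl huv.ne
            | (simp only [Ba', Bb', Bc', mem_coe]
               first
                | exact eab huv
                | exact eac huv
                | exact ebc huv
                | exact sw (eab huv.symm)
                | exact sw (eac huv.symm)
                | exact sw (ebc huv.symm))
      · obtain ⟨x, hx, y, hy, h⟩ := hadj1 v u hv
        exact ⟨y, hy, x, hx, h.symm⟩
    · exact hadj1 u v hu

end Minors

/-! ### Local structure forced by a nonadjacent pair of `F` -/

section CommonNeighbors

open scoped Classical
open Finset

variable {V : Type*} {t : ℕ} {F : SimpleGraph (Fin (t + 3))} {G : SimpleGraph V}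

/-- The form in which `isMinor_of_join` is used: the nonadjacent `a, b` become single vertices and
`c` a set of at most two, so `t + 4` vertices of `R` leave `t` for the pairs. -/
theorem isMinor_of_two_singletons {a b c : Fin (t + 3)} (hab : a ≠ b) (hac : a ≠ c) (hbc : b ≠ c)
    (nab : ¬ F.Adj a b) {T R C : Finset V} (hT : #T = t) (hR : ∀ x ∈ R, ∀ v ∈ T, G.Adj x v)
    (hcard : t + 4 ≤ #R) {x y : V} (hxy : x ≠ y) (hx : x ∈ R) (hy : y ∈ R)
    (hC : (G.induce (C : Set V)).Connected) (hC2 : #C ≤ 2) (hxC : x ∉ C) (hyC : y ∉ C)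
    (hTC : Disjoint T C) (hRC : ∃ z ∈ C, z ∈ R)
    (exC : F.Adj a c → ∃ z ∈ C, G.Adj x z) (eyC : F.Adj b c → ∃ z ∈ C, G.Adj y z) :
    IsMinor F G := by
  have hTR : ∀ v ∈ R, v ∉ T := fun v hv hv' => (hR v hv v hv').ne rfl
  refine isMinor_of_join (Ba := {x}) (Bb := {y}) (Bc := C) hab hac hbc hT hR ?_ ?_ ?_ hC ?_ ?_ ?_
    ?_ ⟨x, by simp, hx⟩ ⟨y, by simp, hy⟩ hRC (fun h => absurd h nab) ?_ ?_
  · have h1 := le_card_sdiff ({x} ∪ {y} ∪ C) R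
    have h2 := card_union_le ({x} ∪ {y}) C
    have h3 := card_union_le ({x} : Finset V) {y}
    rw [card_singleton, card_singleton] at h3
    omega
  · rw [coe_singleton]
    exact connected_induce_singleton G x
  · rw [coe_singleton]
    exact connected_induce_singleton G y
  · simpa using hxy
  · simpa using hxC
  · simpa using hyC
  · rw [disjoint_union_right, disjoint_union_right, disjoint_singleton_right,
      disjoint_singleton_right]
    exact ⟨⟨hTR x hx, hTR y hy⟩, hTC⟩
  · intro h
    obtain ⟨z, hz, hxz⟩ := exC h
    exact ⟨x, by simp, z, hz, hxz⟩
  · intro h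
    obtain ⟨z, hz, hyz⟩ := eyC h
    exact ⟨y, by simp, z, hz, hyz⟩

theorem exists_third (a b : Fin (t + 3)) : ∃ c, a ≠ c ∧ b ≠ c := by
  have h : ({a, b} : Finset (Fin (t + 3))).card < (univ : Finset (Fin (t + 3))).card := by
    rw [card_univ, Fintype.card_fin]
    exact card_le_two.trans_lt (by omega)
  obtain ⟨c, -, hc⟩ := exists_mem_notMem_of_card_lt_card h
  simp only [mem_insert, mem_singleton, not_or] at hc
  exact ⟨c, fun e => hc.1 e.symm, fun e => hc.2 e.symm⟩

/-- The spare vertex `v` of `T`, contracted with some `z ∈ R`, plays `c`; it is adjacent to all of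
`R`. -/
theorem card_common_le (hF : MinorFree F G) {a b : Fin (t + 3)} (hab : a ≠ b)
    (nab : ¬ F.Adj a b) {T R : Finset V} (hT : #T = t + 1)
    (hR : ∀ x ∈ R, ∀ v ∈ T, G.Adj x v) : #R ≤ t + 3 := by
  by_contra hcon
  obtain ⟨c, hac, hbc⟩ := exists_third a b
  obtain ⟨x, hx, y, hy, z, hz, hxy, hxz, hyz⟩ := two_lt_card.1 (show 2 < #R by omega)
  obtain ⟨v, hv⟩ : T.Nonempty := card_pos.1 (by omega)
  have hTR : ∀ v ∈ R, v ∉ T := fun v hv hv' => (hR v hv v hv').ne rfl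
  have hne : ∀ w ∈ R, w ≠ v := fun w hw e => hTR w hw (e ▸ hv)
  refine hF (isMinor_of_two_singletons (T := T.erase v) (R := R) (C := {v, z}) hab hac hbc nab
    (by rw [card_erase_of_mem hv, hT]; rfl) (fun x hx w hw => hR x hx w (mem_of_mem_erase hw))
    (by omega) hxy hx hy ?_ card_le_two ?_ ?_ ?_ ⟨z, by simp, hz⟩ (fun _ => ⟨v, by simp, hR x hx v hv⟩)
    (fun _ => ⟨v, by simp, hR y hy v hv⟩))
  · rw [coe_pair]
    exact SimpleGraph.induce_pair_connected_of_adj (hR z hz v hv).symm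
  · simp only [mem_insert, mem_singleton, not_or]
    exact ⟨hne x hx, hxz⟩
  · simp only [mem_insert, mem_singleton, not_or]
    exact ⟨hne y hy, hyz⟩
  · rw [disjoint_insert_right, disjoint_singleton_right]
    exact ⟨notMem_erase v T, fun h => hTR z hz (mem_of_mem_erase h)⟩

/-- A path `x z y` inside `R` would realise `a, c, b`. So `R` spans a matching. -/
theorem eq_of_adj_of_adj (hF : MinorFree F G) {a b : Fin (t + 3)} (hab : a ≠ b)
    (nab : ¬ F.Adj a b) {T R : Finset V} (hT : #T = t)
    (hR : ∀ x ∈ R, ∀ v ∈ T, G.Adj x v) (hcard : t + 4 ≤ #R) {x y z : V} (hx : x ∈ R)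
    (hy : y ∈ R) (hz : z ∈ R) (hzx : G.Adj z x) (hzy : G.Adj z y) : x = y := by
  by_contra hxy
  obtain ⟨c, hac, hbc⟩ := exists_third a b
  have hTR : ∀ v ∈ R, v ∉ T := fun v hv hv' => (hR v hv v hv').ne rfl
  refine hF (isMinor_of_two_singletons (C := {z}) hab hac hbc nab hT hR hcard hxy hx hy
    (by rw [coe_singleton]; exact connected_induce_singleton G z) (by simp)
    (by simpa using hzx.ne') (by simpa using hzy.ne') (by simpa using hTR z hz) ⟨z, by simp, hz⟩
    (fun _ => ⟨z, by simp, hzx.symm⟩) (fun _ => ⟨z, by simp, hzy.symm⟩))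

/-- With three neighbours `x, y, z` of `e` in `R`, contracting `e z` gives the set for `c`, adjacent
to both `x` and `y`. -/
theorem card_adj_common_le (hF : MinorFree F G) {a b : Fin (t + 3)} (hab : a ≠ b)
    (nab : ¬ F.Adj a b) {T R : Finset V} (hT : #T = t)
    (hR : ∀ x ∈ R, ∀ v ∈ T, G.Adj x v) (hcard : t + 4 ≤ #R) {e : V} (heT : e ∉ T) :
    #{x ∈ R | G.Adj e x} ≤ 2 := by
  by_contra hcon
  obtain ⟨c, hac, hbc⟩ := exists_third a b
  obtain ⟨x, hx, y, hy, z, hz, hxy, hxz, hyz⟩ := two_lt_card.1 (not_le.1 hcon)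
  rw [mem_filter] at hx hy hz
  have hTR : ∀ v ∈ R, v ∉ T := fun v hv hv' => (hR v hv v hv').ne rfl
  refine hF (isMinor_of_two_singletons (C := {e, z}) hab hac hbc nab hT hR hcard hxy hx.1 hy.1
    ?_ card_le_two ?_ ?_ ?_ ⟨z, by simp, hz.1⟩ (fun _ => ⟨e, by simp, hx.2.symm⟩)
    (fun _ => ⟨e, by simp, hy.2.symm⟩))
  · rw [coe_pair]
    exact SimpleGraph.induce_pair_connected_of_adj hz.2
  · simp only [mem_insert, mem_singleton, not_or]
    exact ⟨hx.2.ne', hxz⟩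
  · simp only [mem_insert, mem_singleton, not_or]
    exact ⟨hy.2.ne', hyz⟩
  · rw [disjoint_insert_right, disjoint_singleton_right]
    exact ⟨heT, hTR z hz.1⟩

/-- When `b` is adjacent to neither `a` nor `c`, a single edge of `R` suffices for `a` and `c`, and
any third vertex of `R` serves as `b`. -/
theorem not_adj_of_common (hF : MinorFree F G) {a b c : Fin (t + 3)} (hab : a ≠ b) (hac : a ≠ c)
    (hbc : b ≠ c) (nab : ¬ F.Adj a b) (nbc : ¬ F.Adj b c) {T R : Finset V} (hT : #T = t)
    (hR : ∀ x ∈ R, ∀ v ∈ T, G.Adj x v) (hcard : t + 4 ≤ #R) {x z : V} (hx : x ∈ R)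
    (hz : z ∈ R) : ¬ G.Adj x z := by
  intro hxz
  have hTR : ∀ v ∈ R, v ∉ T := fun v hv hv' => (hR v hv v hv').ne rfl
  obtain ⟨y, hy, hy'⟩ := exists_mem_notMem_of_card_lt_card
    (show #({x, z} : Finset V) < #R from card_le_two.trans_lt (by omega))
  simp only [mem_insert, mem_singleton, not_or] at hy'
  exact hF (isMinor_of_two_singletons (C := {z}) hab hac hbc nab hT hR hcard
    (fun e => hy'.1 e.symm) hx hy
    (by rw [coe_singleton]; exact connected_induce_singleton G z) (by simp)
    (by simpa using hxz.ne) (by simpa using hy'.2) (by simpa using hTR z hz) ⟨z, by simp, hz⟩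
    (fun _ => ⟨z, by simp, hxz⟩) (fun h => absurd h nbc))

end CommonNeighbors

/-! ### Two-step walks and the number of vertices of given weight -/

section Core

open scoped Classical
open Finset

variable {V : Type*} [Fintype V] {G : SimpleGraph V} {D : ℕ} {x : V → ℝ}

theorem sum_degree_le (hD : ∀ S, degSum G S ≤ D * #S) (S : Finset V) :
    ∑ w ∈ S, (#{u | G.Adj w u} : ℝ) ≤ D * Fintype.card V := by
  have h1 : ∑ w ∈ S, (#{u | G.Adj w u} : ℝ) ≤ ∑ w, (#{u | G.Adj w u} : ℝ) :=
    sum_le_sum_of_subset_of_nonneg (subset_univ _) fun _ _ _ => Nat.cast_nonneg _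
  have h2 := hD univ
  rw [degSum, card_univ] at h2
  exact h1.trans (by exact_mod_cast h2)

theorem sum_adj_le (hD : ∀ S, degSum G S ≤ D * #S) (L : Finset V) (v : V) :
    ∑ w with G.Adj v w, (#{u ∈ L | G.Adj w u} : ℝ) ≤ D * (#{u | G.Adj v u} + #L) := by
  have h2 := hD (({u | G.Adj v u} : Finset V) ∪ L)
  have h3 : ∑ w with G.Adj v w, #{u ∈ L | G.Adj w u} ≤ degSum G (({u | G.Adj v u} : Finset V) ∪ L) := by
    refine le_trans ?_ (sum_le_sum_of_subset (s := {u | G.Adj v u}) subset_union_left)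
    exact sum_le_sum fun w _ => card_le_card (filter_subset_filter _ subset_union_right)
  have h4 := h3.trans (h2.trans (Nat.mul_le_mul_left D (card_union_le _ _)))
  exact_mod_cast h4

theorem lam_mul_le_degree (hx1 : ∀ u, x u ≤ 1)
    (heig : ∀ u, ∑ v with G.Adj u v, x v = lam G * x u) (v : V) :
    lam G * x v ≤ #{u | G.Adj v u} := by
  rw [← heig v]
  refine (sum_le_sum fun u _ => hx1 u).trans ?_
  simp

theorem sum_level_le_card {V : Type*} {G : SimpleGraph V} {x : V → ℝ} (hx1 : ∀ u, x u ≤ 1) (L S : Finset V) :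
    ∑ w ∈ S, ∑ u ∈ L with G.Adj w u, x u ≤ ∑ w ∈ S, (#{u ∈ L | G.Adj w u} : ℝ) := by
  refine sum_le_sum fun w _ => (sum_le_sum fun u _ => hx1 u).trans ?_
  simp

theorem lam_sq_mul (heig : ∀ u, ∑ v with G.Adj u v, x v = lam G * x u) (v : V) :
    lam G ^ 2 * x v = ∑ w with G.Adj v w, ∑ u with G.Adj w u, x u := by
  simp only [heig]
  rw [← mul_sum, heig]
  ring

/-- Two-step walks from `v` are split by the weight of their endpoint. Those ending below `ε`
contribute at most `ε` times the total degree. -/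
theorem lam_sq_mul_le (hD : ∀ S, degSum G S ≤ D * #S)
    (heig : ∀ u, ∑ v with G.Adj u v, x v = lam G * x u) {ε : ℝ} (hε : 0 ≤ ε) (v : V) :
    lam G ^ 2 * x v ≤ (∑ w with G.Adj v w, ∑ u ∈ {u | ε ≤ x u} with G.Adj w u, x u) +
      ε * D * Fintype.card V := by
  rw [lam_sq_mul heig]
  have h1 : ∀ w, ∑ u with G.Adj w u, x u ≤
      (∑ u ∈ {u | ε ≤ x u} with G.Adj w u, x u) + ε * #{u | G.Adj w u} := by
    intro w
    rw [← sum_filter_add_sum_filter_not {u | G.Adj w u} (fun u => ε ≤ x u)]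
    refine add_le_add (le_of_eq ?_) ?_
    · refine sum_congr ?_ fun _ _ => rfl
      ext u
      simp [and_comm]
    · calc ∑ u ∈ {u | G.Adj w u} with ¬ ε ≤ x u, x u
          ≤ ∑ u ∈ {u | G.Adj w u} with ¬ ε ≤ x u, ε :=
            sum_le_sum fun u hu => (not_le.1 (mem_filter.1 hu).2).le
        _ = ε * #({u ∈ {u | G.Adj w u} | ¬ ε ≤ x u}) := by rw [sum_const, nsmul_eq_mul, mul_comm]
        _ ≤ _ := by
          gcongr
          exact filter_subset _ _
  refine (sum_le_sum fun w _ => h1 w).trans ?_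
  rw [sum_add_distrib, ← mul_sum, mul_assoc]
  gcongr
  exact sum_degree_le hD _

theorem card_level_le (hD : ∀ S, degSum G S ≤ D * #S) (hx1 : ∀ u, x u ≤ 1)
    (heig : ∀ u, ∑ v with G.Adj u v, x v = lam G * x u) (h0 : 0 ≤ lam G) (ε : ℝ) :
    lam G * ε * #{u | ε ≤ x u} ≤ D * Fintype.card V := by
  refine le_trans ?_ (sum_degree_le hD {u | ε ≤ x u})
  rw [mul_comm, ← nsmul_eq_mul, ← sum_const]
  refine sum_le_sum fun u hu => ?_
  rw [mem_filter] at hu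
  exact (mul_le_mul_of_nonneg_left hu.2 h0).trans (lam_mul_le_degree hx1 heig u)

/-- The set of vertices of large weight has bounded size. -/
theorem card_level_bounded (hD1 : 1 ≤ D) (hD : ∀ S, degSum G S ≤ D * #S)
    (hx1 : ∀ u, x u ≤ 1)
    (heig : ∀ u, ∑ v with G.Adj u v, x v = lam G * x u) (h0 : 0 ≤ lam G) {ε : ℝ} (hε : 0 < ε)
    (hn : (Fintype.card V : ℝ) / 2 ≤ lam G ^ 2)
    (hlam : 64 * D ^ 3 ≤ ε ^ 2 * lam G) :
    (#{u | ε ≤ x u} : ℝ) ≤ 4 * D ^ 2 / ε := by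
  have hDr : (1 : ℝ) ≤ D := by exact_mod_cast hD1
  set n : ℝ := (Fintype.card V : ℝ) with hndef
  rcases (show (0 : ℝ) ≤ n from Nat.cast_nonneg _).eq_or_lt with hn0 | hn0
  · have : #{u | ε ≤ x u} ≤ Fintype.card V := card_le_univ _
    have h2 : (#{u | ε ≤ x u} : ℝ) ≤ n := Nat.cast_le.2 this
    rw [← hn0] at h2
    exact h2.trans (by positivity)
  have hlpos : 0 < lam G := by
    by_contra hc
    have : lam G = 0 := le_antisymm (not_lt.1 hc) h0
    rw [this] at hn
    nlinarith
  set ε' : ℝ := ε / (8 * D) with hε'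
  have hε'0 : 0 < ε' := by positivity
  have hεε' : ε = 8 * D * ε' := by rw [hε']; field_simp
  have hL' : (#{u | ε' ≤ x u} : ℝ) ≤ ε' * n := by
    have h1 := card_level_le hD hx1 heig h0 ε'
    have h2 : (D : ℝ) ≤ lam G * ε' * ε' := by
      have : ε ^ 2 * lam G = 64 * D ^ 2 * (lam G * ε' * ε') := by rw [hεε']; ring
      rw [this] at hlam
      have h3 : (0 : ℝ) < 64 * D ^ 2 := by positivity
      refine le_of_mul_le_mul_left ?_ h3
      linarith
    have h3 : lam G * ε' * #{u | ε' ≤ x u} ≤ lam G * ε' * (ε' * n) := by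
      refine h1.trans ?_
      rw [← mul_assoc]
      exact mul_le_mul_of_nonneg_right h2 hn0.le
    exact le_of_mul_le_mul_left h3 (by positivity)
  have hdeg : ∀ v ∈ ({u | ε ≤ x u} : Finset V), ε * n / 4 ≤ D * #{u | G.Adj v u} := by
    intro v hv
    rw [mem_filter] at hv
    have h1 := lam_sq_mul_le hD heig hε'0.le v
    have h2 := (sum_level_le_card (G := G) hx1 {u | ε' ≤ x u} {w | G.Adj v w}).trans
      (sum_adj_le hD _ v)
    have h3 : n / 2 * ε ≤ lam G ^ 2 * x v := mul_le_mul hn hv.2 hε.le (sq_nonneg _)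
    have h4 : (D : ℝ) * #{u | ε' ≤ x u} ≤ D * (ε' * n) :=
      mul_le_mul_of_nonneg_left hL' (by positivity)
    have h5 : ε * n = 8 * (D * (ε' * n)) := by rw [hεε']; ring
    linarith
  have hsum : (#{u | ε ≤ x u} : ℝ) * (ε * n / 4) ≤ D * (D * n) := by
    rw [← nsmul_eq_mul, ← sum_const]
    refine (sum_le_sum hdeg).trans ?_
    rw [← mul_sum]
    exact mul_le_mul_of_nonneg_left (sum_degree_le hD _) (by positivity)
  rw [le_div_iff₀ hε]
  refine le_of_mul_le_mul_right ?_ hn0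
  linarith

theorem card_many_adj_le {t M : ℕ}
    (hK : ∀ T R : Finset V, #T = t + 1 → (∀ w ∈ R, ∀ v ∈ T, G.Adj w v) → #R ≤ M)
    (L : Finset V) : #{w | t + 1 ≤ #{u ∈ L | G.Adj w u}} ≤ 2 ^ #L * M := by
  have hsub : ({w | t + 1 ≤ #{u ∈ L | G.Adj w u}} : Finset V) ⊆
      (L.powersetCard (t + 1)).biUnion fun T => {w | ∀ v ∈ T, G.Adj w v} := by
    intro w hw
    rw [mem_filter] at hw
    obtain ⟨T, hT, hTc⟩ := exists_subset_card_eq hw.2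
    rw [mem_biUnion]
    refine ⟨T, mem_powersetCard.2 ⟨hT.trans (filter_subset _ _), hTc⟩, ?_⟩
    rw [mem_filter]
    exact ⟨mem_univ _, fun v hv => (mem_filter.1 (hT hv)).2⟩
  refine (card_le_card hsub).trans ((card_biUnion_le_card_mul _ _ M fun T hT => ?_).trans ?_)
  · exact hK T _ (mem_powersetCard.1 hT).2 fun w hw => (mem_filter.1 hw).2
  · refine Nat.mul_le_mul_right _ ?_
    rw [card_powersetCard]
    exact Nat.choose_le_two_pow _ _

/-- All vertices have at most `t` neighbours in `L`, except those counted by `card_many_adj_le`,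
which have at most `#L`. For bounded `L` the exceptions cost only a constant. -/
theorem sum_card_adj_le {t M : ℕ}
    (hK : ∀ T R : Finset V, #T = t + 1 → (∀ w ∈ R, ∀ v ∈ T, G.Adj w v) → #R ≤ M)
    (L S : Finset V) :
    ∑ w ∈ S, (#{u ∈ L | G.Adj w u} : ℝ) ≤ t * #S + #L * (2 ^ #L * M) := by
  have h1 : ∀ w ∈ S, #{u ∈ L | G.Adj w u} ≤
      t + #L * if t + 1 ≤ #{u ∈ L | G.Adj w u} then 1 else 0 := by
    intro w _
    split_ifs with h
    · have := card_le_card (filter_subset (fun u => G.Adj w u) L)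
      omega
    · omega
  have h2 := sum_le_sum h1
  rw [sum_add_distrib, ← mul_sum, sum_const, ← card_filter, smul_eq_mul] at h2
  have h3 : #{w ∈ S | t + 1 ≤ #{u ∈ L | G.Adj w u}} ≤ 2 ^ #L * M :=
    (card_le_card (filter_subset_filter _ (subset_univ S))).trans (card_many_adj_le hK L)
  have h4 := h2.trans (Nat.add_le_add_left (Nat.mul_le_mul_left #L h3) _)
  rw [mul_comm (#S)] at h4
  exact_mod_cast h4

theorem card_common_ge (T : Finset V) {a : ℝ}
    (ha : ∀ v ∈ T, (Fintype.card V : ℝ) - a ≤ #{u | G.Adj v u}) :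
    (Fintype.card V : ℝ) - #T * a ≤ #{w | ∀ v ∈ T, G.Adj w v} := by
  have h1 : (univ : Finset V) ⊆ ({w | ∀ v ∈ T, G.Adj w v} : Finset V) ∪
      T.biUnion fun v => ({u | G.Adj v u} : Finset V)ᶜ := by
    intro w _
    by_cases h : ∀ v ∈ T, G.Adj w v
    · exact mem_union_left _ (mem_filter.2 ⟨mem_univ _, h⟩)
    · push Not at h
      obtain ⟨v, hv, hvw⟩ := h
      refine mem_union_right _ (mem_biUnion.2 ⟨v, hv, ?_⟩)
      simpa [G.adj_comm] using hvw
  have h2 := (card_le_card h1).trans (card_union_le _ _)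
  have h3 : (#(T.biUnion fun v => ({u | G.Adj v u} : Finset V)ᶜ) : ℝ) ≤ #T * a := by
    rw [← nsmul_eq_mul, ← sum_const]
    have h5 := card_biUnion_le (s := T) (t := fun v => ({u | G.Adj v u} : Finset V)ᶜ)
    have h6 : (#(T.biUnion fun v => ({u | G.Adj v u} : Finset V)ᶜ) : ℝ) ≤
        ∑ v ∈ T, (#(({u | G.Adj v u} : Finset V)ᶜ) : ℝ) := by exact_mod_cast h5
    refine h6.trans (sum_le_sum fun v hv => ?_)
    rw [card_compl, Nat.cast_sub (card_le_univ _)]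
    have := ha v hv
    linarith
  rw [card_univ] at h2
  have h4 : (Fintype.card V : ℝ) ≤ #{w | ∀ v ∈ T, G.Adj w v} +
      #(T.biUnion fun v => ({u | G.Adj v u} : Finset V)ᶜ) := by exact_mod_cast h2
  linarith

end Core

/-! ### Isolating exactly `t` heavy vertices -/

section Core

open scoped Classical
open Finset

variable {V : Type*} [Fintype V] {G : SimpleGraph V} {D t M : ℕ} {x : V → ℝ}

/-- Together with `λ² ≥ (t - ε) n` this turns weight into degree: a vertex of weight `x v` has
nearly `x v * n` neighbours. -/
theorem lam_sq_mul_le_degree (hD : ∀ S, degSum G S ≤ D * #S) (hx1 : ∀ u, x u ≤ 1)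
    (heig : ∀ u, ∑ v with G.Adj u v, x v = lam G * x u)
    (hK : ∀ T R : Finset V, #T = t + 1 → (∀ w ∈ R, ∀ v ∈ T, G.Adj w v) → #R ≤ M)
    {ε : ℝ} (hε : 0 ≤ ε)
    (hL : (#{u | ε ≤ x u} * (2 ^ #{u | ε ≤ x u} * M) : ℝ) ≤ ε * Fintype.card V) (v : V) :
    lam G ^ 2 * x v ≤ t * #{u | G.Adj v u} + ε * (D + 1) * Fintype.card V := by
  have h1 := lam_sq_mul_le hD heig hε v
  have h2 := (sum_level_le_card (G := G) hx1 {u | ε ≤ x u} {w | G.Adj v w}).trans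
    (sum_card_adj_le hK _ _)
  linarith

/-- A vertex of weight at least `η` has weight close to `1`. -/
theorem one_sub_le_of_level (hD : ∀ S, degSum G S ≤ D * #S) (hx1 : ∀ u, x u ≤ 1)
    (heig : ∀ u, ∑ v with G.Adj u v, x v = lam G * x u)
    (hK : ∀ T R : Finset V, #T = t + 1 → (∀ w ∈ R, ∀ v ∈ T, G.Adj w v) → #R ≤ M)
    {ε η : ℝ} (hε : 0 ≤ ε)
    (hL : (#{u | ε ≤ x u} * (2 ^ #{u | ε ≤ x u} * M) : ℝ) ≤ ε * Fintype.card V)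
    (hdeg : ∀ v, (x v - (D + 2) * ε) * Fintype.card V ≤ #{u | G.Adj v u})
    (hlam : (t - ε) * Fintype.card V ≤ lam G ^ 2) (hn : 0 < Fintype.card V) {m : V} (hm : x m = 1)
    (hη : 0 < η) (hηε : 4 * (D + 2) * ε ≤ η) {u : V} (hu : η ≤ x u) :
    η * (1 - x u) ≤ 2 * (D + 2) * ε := by
  have hnr : (0 : ℝ) < Fintype.card V := by exact_mod_cast hn
  set n : ℝ := (Fintype.card V : ℝ) with hndef
  have hD0 : (0 : ℝ) ≤ D := Nat.cast_nonneg _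
  have hηε' : ε ≤ η := by nlinarith
  -- The number of common neighbours of `m` and `u`, that is, of two-step walks from `m` to `u`.
  let c : V → ℝ := fun u => #{w ∈ ({w | G.Adj m w} : Finset V) | G.Adj w u}
  have hc0 : ∀ u, 0 ≤ c u := fun u => Nat.cast_nonneg _
  have hswap : ∀ f : V → ℝ, ∑ w with G.Adj m w, ∑ u ∈ {u | ε ≤ x u} with G.Adj w u, f u =
      ∑ u with ε ≤ x u, c u * f u := by
    intro f
    have h (w : V) : ∑ u ∈ {u | ε ≤ x u} with G.Adj w u, f u =
        ∑ u with ε ≤ x u, if G.Adj w u then f u else 0 := sum_filter _ _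
    simp only [h]
    rw [sum_comm]
    refine sum_congr rfl fun u _ => ?_
    rw [← sum_filter, sum_const, nsmul_eq_mul]
  have h1 := lam_sq_mul_le hD heig hε m
  rw [hswap, hm, mul_one] at h1
  have h2 := sum_card_adj_le hK {u | ε ≤ x u} {w | G.Adj m w}
  have h3 : ∑ w with G.Adj m w, (#{u ∈ ({u | ε ≤ x u} : Finset V) | G.Adj w u} : ℝ) =
      ∑ u with ε ≤ x u, c u * 1 := by
    rw [← hswap]
    refine sum_congr rfl fun w _ => ?_
    simp
  rw [h3] at h2
  have hdm : (#{w | G.Adj m w} : ℝ) ≤ n := Nat.cast_le.2 (card_le_univ _)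
  -- The walks from `m` number at most about `t n`, yet their weighted count is at least about `t
  -- n`, so the total deficiency is small. A vertex of weight at least `η` shares at least `η n / 2`
  -- neighbours with `m`, so its own deficiency must be small.
  have h4 : ∑ u with ε ≤ x u, c u * (1 - x u) ≤ (D + 2) * ε * n := by
    simp only [mul_sub, sum_sub_distrib]
    have : (t : ℝ) * #{w | G.Adj m w} ≤ t * n := by gcongr
    linarith
  have h5 : c u * (1 - x u) ≤ (D + 2) * ε * n := by
    refine le_trans ?_ h4
    exact single_le_sum (f := fun u => c u * (1 - x u))
      (fun v _ => mul_nonneg (hc0 v) (sub_nonneg.2 (hx1 v)))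
      (mem_filter.2 ⟨mem_univ u, hηε'.trans hu⟩)
  have h6 : (#{w | G.Adj m w} : ℝ) + #{w | G.Adj u w} ≤ n + c u := by
    have e : ({w ∈ ({w | G.Adj m w} : Finset V) | G.Adj w u} : Finset V) =
        ({w | G.Adj m w} : Finset V) ∩ ({w | G.Adj u w} : Finset V) := by
      ext w
      simp [G.adj_comm]
    have h7 := card_union_add_card_inter ({w | G.Adj m w} : Finset V) ({w | G.Adj u w} : Finset V)
    have h8 : #(({w | G.Adj m w} : Finset V) ∪ ({w | G.Adj u w} : Finset V)) ≤ Fintype.card V := card_le_univ _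
    have h9 : #({w | G.Adj m w} : Finset V) + #({w | G.Adj u w} : Finset V) ≤ Fintype.card V +
        #(({w | G.Adj m w} : Finset V) ∩ ({w | G.Adj u w} : Finset V)) := by omega
    simp only [c, e, hndef]
    exact_mod_cast h9
  have h7 := hdeg m
  have h8 := hdeg u
  rw [hm] at h7
  have h9 : η / 2 * n ≤ c u := by nlinarith
  have h10 : η / 2 * n * (1 - x u) ≤ (D + 2) * ε * n :=
    (mul_le_mul_of_nonneg_right h9 (sub_nonneg.2 (hx1 u))).trans h5
  refine le_of_mul_le_mul_right ?_ hnr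
  linarith

/-- In a sparse graph without `K_{t+1,M}` whose spectral radius is at least that of `K_{t,n-t}`,
exactly `t` vertices carry large weight, and these have many common neighbours. -/
theorem exists_heavy_set (t D M : ℕ) (ht : 1 ≤ t) (hD1 : 1 ≤ D) :
    ∃ N : ℕ, ∀ (V : Type) [Fintype V] (G : SimpleGraph V) (x : V → ℝ),
      N ≤ Fintype.card V → (∀ S, degSum G S ≤ D * #S) →
      (∀ T R : Finset V, #T = t + 1 → (∀ w ∈ R, ∀ v ∈ T, G.Adj w v) → #R ≤ M) →
      (t : ℝ) * (Fintype.card V - t) ≤ lam G ^ 2 → (∀ u, 0 ≤ x u) → (∀ u, x u ≤ 1) →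
      (∃ u, x u = 1) → (∀ u, ∑ v with G.Adj u v, x v = lam G * x u) →
      ∃ T : Finset V, #T = t ∧ (∀ v ∈ T, 1 / 2 ≤ x v) ∧
        (∀ v ∉ T, x v ≤ 1 / (4 * (D + 2))) ∧
        Fintype.card V ≤ 2 * #{w | ∀ v ∈ T, G.Adj w v} := by
  have htr : (1 : ℝ) ≤ t := by exact_mod_cast ht
  have hDr : (1 : ℝ) ≤ D := by exact_mod_cast hD1
  -- `η` is the lightness needed in `eq_of_heavy_set`. `δ` is chosen so that `t + 1` vertices, each
  -- missing at most `2 δ n` others, still have `n / 2` common neighbours. `ε` makes the deficiency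
  -- from `one_sub_le_of_level` at most `δ`.
  obtain ⟨η, hη⟩ : ∃ η : ℝ, η = 1 / (4 * (D + 2)) := ⟨_, rfl⟩
  have hη0 : 0 < η := by rw [hη]; positivity
  have hηD : η * (D + 2) = 1 / 4 := by rw [hη]; field_simp
  obtain ⟨δ, hδ⟩ : ∃ δ : ℝ, δ = 1 / (4 * (t + 1)) := ⟨_, rfl⟩
  have hδ0 : 0 < δ := by rw [hδ]; positivity
  have hδt : (t + 1) * δ = 1 / 4 := by rw [hδ]; field_simp
  have hδ8 : δ ≤ 1 / 8 := by nlinarith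
  obtain ⟨ε, hε⟩ : ∃ ε : ℝ, ε = η * δ / (4 * (D + 2)) := ⟨_, rfl⟩
  have hε0 : 0 < ε := by rw [hε]; positivity
  have hεc : 4 * (D + 2) * ε = η * δ := by rw [hε]; field_simp
  have hη1 : η ≤ 1 / 12 := by nlinarith
  have hε1 : ε ≤ 1 / 8 := by nlinarith
  obtain ⟨K, hK⟩ := exists_nat_ge (4 * (D : ℝ) ^ 2 / ε)
  obtain ⟨N1, hN1⟩ := exists_nat_ge (K * (2 ^ K * M) / ε)
  obtain ⟨N2, hN2⟩ := exists_nat_ge (2 * (64 * D ^ 3 / ε ^ 2) ^ 2)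
  obtain ⟨N3, hN3⟩ := exists_nat_ge ((t : ℝ) ^ 2 / ε)
  refine ⟨N1 + N2 + N3 + 2 * t + 2 * M + 1, ?_⟩
  intro V _ G x hN hD hfree hlam hx0 hx1 ⟨m, hm⟩ heig
  have : Nonempty V := ⟨m⟩
  have hl0 : 0 ≤ lam G := lam_nonneg G
  have hNr : (N1 : ℝ) + N2 + N3 + 2 * t + 2 * M + 1 ≤ Fintype.card V := by exact_mod_cast hN
  have hn0 : 0 < Fintype.card V := by omega
  obtain ⟨n, hn⟩ : ∃ n : ℝ, n = Fintype.card V := ⟨_, rfl⟩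
  rw [← hn] at hNr hlam
  have p1 : (0 : ℝ) ≤ N1 := Nat.cast_nonneg _
  have p2 : (0 : ℝ) ≤ N2 := Nat.cast_nonneg _
  have p3 : (0 : ℝ) ≤ N3 := Nat.cast_nonneg _
  have p4 : (0 : ℝ) ≤ M := Nat.cast_nonneg _
  have hnpos : 0 < n := by linarith
  have hhalf : n / 2 ≤ lam G ^ 2 := by
    have := mul_le_mul_of_nonneg_right htr (show 0 ≤ n - t by linarith)
    linarith
  have hlamε : (t - ε) * n ≤ lam G ^ 2 := by
    have : (t : ℝ) ^ 2 ≤ ε * n := by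
      rw [div_le_iff₀ hε0] at hN3
      have := mul_le_mul_of_nonneg_right (show (N3 : ℝ) ≤ n by linarith) hε0.le
      linarith
    linarith
  have hlamD : 64 * (D : ℝ) ^ 3 ≤ ε ^ 2 * lam G := by
    have h1 : (64 * D ^ 3 / ε ^ 2) ^ 2 ≤ lam G ^ 2 := by linarith
    have h2 := abs_le_of_sq_le_sq h1 hl0
    have h3 := (le_abs_self _).trans h2
    rw [div_le_iff₀ (by positivity)] at h3
    linarith
  have hLK : (#{u | ε ≤ x u} : ℝ) ≤ K :=
    (card_level_bounded hD1 hD hx1 heig hl0 hε0 (by rw [← hn]; exact hhalf) hlamD).trans hK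
  have hLK' : #{u | ε ≤ x u} ≤ K := by exact_mod_cast hLK
  have hL : (#{u | ε ≤ x u} * (2 ^ #{u | ε ≤ x u} * M) : ℝ) ≤ ε * Fintype.card V := by
    rw [← hn]
    calc (#{u | ε ≤ x u} * (2 ^ #{u | ε ≤ x u} * M) : ℝ) ≤ K * (2 ^ K * M) := by
          gcongr
          norm_num
      _ ≤ N1 * ε := by rwa [div_le_iff₀ hε0] at hN1
      _ ≤ ε * n := by
        rw [mul_comm]
        exact mul_le_mul_of_nonneg_left (by linarith) hε0.le
  have hdeg : ∀ v, (x v - (D + 2) * ε) * Fintype.card V ≤ #{u | G.Adj v u} := by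
    intro v
    have h1 := lam_sq_mul_le_degree hD hx1 heig hfree hε0.le hL v
    have h2 : (t - ε) * n * x v ≤ lam G ^ 2 * x v := mul_le_mul_of_nonneg_right hlamε (hx0 v)
    rw [← hn] at h1 ⊢
    have h3 : ε * n * x v ≤ ε * n := mul_le_of_le_one_right (by positivity) (hx1 v)
    have h4 : t * (x v * n) ≤ t * (#{u | G.Adj v u} + (D + 2) * ε * n) := by
      have : (D + 2) * ε * n ≤ t * ((D + 2) * ε * n) := le_mul_of_one_le_left (by positivity) htr
      linarith
    have h5 := le_of_mul_le_mul_left h4 (by linarith)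
    linarith
  have hheavy : ∀ u, η ≤ x u → 1 - δ ≤ x u := by
    intro u hu
    have h1 := one_sub_le_of_level hD hx1 heig hfree hε0.le hL hdeg (by rw [← hn]; exact hlamε)
      hn0 hm hη0 (by rw [hεc]; exact mul_le_of_le_one_right hη0.le (by linarith)) hu
    have h3 := mul_pos hη0 hδ0
    have h2 : η * (1 - x u) ≤ η * δ := by linarith
    have := le_of_mul_le_mul_left h2 hη0
    linarith
  have hdegT : ∀ u, η ≤ x u → (Fintype.card V : ℝ) - 2 * δ * n ≤ #{w | G.Adj u w} := by
    intro u hu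
    refine le_trans ?_ (hdeg u)
    rw [← hn]
    have h1 := hheavy u hu
    have h2 : η * δ ≤ δ := mul_le_of_le_one_left hδ0.le (by linarith)
    have h3 := mul_le_mul_of_nonneg_right (show 1 - 2 * δ ≤ x u - (D + 2) * ε by linarith) hnpos.le
    linarith
  have hcommon : ∀ T : Finset V, (∀ u ∈ T, η ≤ x u) → #T ≤ t + 1 →
      n / 2 ≤ #{w | ∀ v ∈ T, G.Adj w v} := by
    intro T hT hTc
    have h1 := card_common_ge (G := G) T (a := 2 * δ * n) fun v hv => hdegT v (hT v hv)
    rw [← hn] at h1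
    have h2 : (#T : ℝ) ≤ t + 1 := by exact_mod_cast hTc
    have h3 : (#T : ℝ) * (2 * δ * n) ≤ (t + 1) * (2 * δ * n) := by gcongr
    have h4 : (t + 1) * (2 * δ * n) = 2 * n * ((t + 1) * δ) := by ring
    rw [h4, hδt] at h3
    linarith
  -- Otherwise `t + 1` heavy vertices would have `n / 2 > M` common neighbours.
  have hle : #{u | η ≤ x u} ≤ t := by
    by_contra hcon
    obtain ⟨T, hT, hTc⟩ := exists_subset_card_eq (show t + 1 ≤ #{u | η ≤ x u} by omega)
    have h1 := hcommon T (fun u hu => (mem_filter.1 (hT hu)).2) hTc.le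
    have h2 := hfree T {w | ∀ v ∈ T, G.Adj w v} hTc fun w hw => (mem_filter.1 hw).2
    have h3 : (#{w | ∀ v ∈ T, G.Adj w v} : ℝ) ≤ M := by exact_mod_cast h2
    linarith
  -- With fewer than `t` heavy vertices, two-step walks from `m` give `λ² ≤ (t - 1) n + η D n`,
  -- below `(t - ε) n`.
  have hge : t ≤ #{u | η ≤ x u} := by
    by_contra hcon
    have h1 := lam_sq_mul_le hD heig hη0.le m
    have h2 := sum_level_le_card (G := G) hx1 {u | η ≤ x u} {w | G.Adj m w}
    have h3 : ∑ w with G.Adj m w, (#{u ∈ ({u | η ≤ x u} : Finset V) | G.Adj w u} : ℝ) ≤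
        n * (t - 1) := by
      calc _ ≤ ∑ w with G.Adj m w, ((t : ℝ) - 1) := by
            refine sum_le_sum fun w _ => ?_
            have h4 := card_le_card (filter_subset (fun u => G.Adj w u) {u | η ≤ x u})
            have h5 : #{u ∈ ({u | η ≤ x u} : Finset V) | G.Adj w u} + 1 ≤ t := by omega
            have h6 : (#{u ∈ ({u | η ≤ x u} : Finset V) | G.Adj w u} : ℝ) + 1 ≤ t := by
              exact_mod_cast h5
            linarith
        _ = #{w | G.Adj m w} * ((t : ℝ) - 1) := by rw [sum_const, nsmul_eq_mul]
        _ ≤ _ := by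
          rw [hn]
          refine mul_le_mul_of_nonneg_right (Nat.cast_le.2 (card_le_univ _)) (by linarith)
    rw [hm, mul_one, ← hn] at h1
    have h7 : η * D ≤ 1 / 4 := by linarith
    have h8 := mul_le_mul_of_nonneg_right h7 hnpos.le
    have h9 := mul_le_mul_of_nonneg_right hε1 hnpos.le
    linarith
  refine ⟨({u | η ≤ x u} : Finset V), le_antisymm hle hge, fun v hv => ?_, fun v hv => ?_, ?_⟩
  · have := hheavy v (mem_filter.1 hv).2
    linarith
  · rw [← hη]
    simp only [mem_filter, mem_univ, true_and, not_le] at hv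
    exact hv.le
  · have h1 := hcommon {u | η ≤ x u} (fun u hu => (mem_filter.1 hu).2) (by omega)
    rw [hn] at h1
    have h2 : (Fintype.card V : ℝ) ≤ 2 * #{w | ∀ v ∈ ({u | η ≤ x u} : Finset V), G.Adj w v} := by
      linarith
    exact_mod_cast h2

end Core

/-! ### Comparing quadratic forms with the target graph -/

section Comparison

open scoped Classical
open Finset

/-- Degeneracy: some vertex `w` of `S` has at most `D` neighbours in `S`, and removing it costs at
most `2 D η x w`. -/
theorem sum_sum_adj_le {V : Type*} {G : SimpleGraph V} {D : ℕ} (hD : ∀ S, degSum G S ≤ D * #S)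
    {x : V → ℝ} (hx0 : ∀ u, 0 ≤ x u) {η : ℝ} (hη : 0 ≤ η) (S : Finset V)
    (hS : ∀ u ∈ S, x u ≤ η) :
    ∑ u ∈ S, ∑ v ∈ S, (if G.Adj u v then x u * x v else 0) ≤ 2 * D * η * ∑ u ∈ S, x u := by
  induction S using Finset.strongInduction with
  | H S ih =>
  rcases S.eq_empty_or_nonempty with rfl | hne
  · simp
  obtain ⟨w, hw, hwD⟩ : ∃ w ∈ S, #{v ∈ S | G.Adj w v} ≤ D := by
    refine exists_le_of_sum_le (g := fun _ => D) hne ?_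
    rw [sum_const, smul_eq_mul, mul_comm]
    exact hD S
  rw [sum_sum_erase S (fun u v => if G.Adj u v then x u * x v else 0)
    (fun u v => by simp [G.adj_comm, mul_comm]) (fun u => by simp) hw, ← add_sum_erase S x hw]
  have h1 := ih (S.erase w) (erase_ssubset hw) fun u hu => hS u (mem_of_mem_erase hu)
  have h2 : ∑ v ∈ S, (if G.Adj w v then x w * x v else 0) ≤ x w * (D * η) := by
    rw [← sum_filter, ← mul_sum]
    refine mul_le_mul_of_nonneg_left ?_ (hx0 w)
    calc ∑ v ∈ S with G.Adj w v, x v ≤ ∑ v ∈ S with G.Adj w v, η :=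
          sum_le_sum fun v hv => hS v (mem_filter.1 hv).1
      _ = #{v ∈ S | G.Adj w v} * η := by rw [sum_const, nsmul_eq_mul]
      _ ≤ D * η := by gcongr
  linarith

/-- Let `E` be the set of vertices outside `T` and `R`. Passing from `G` to `H` adds an edge from
each `e ∈ E` to a vertex of weight at least `1/2`, and can lose only edges within `E` or between `E`
and `R`. The loss is at most half of the gain, while `lam H ≤ lam G` allows no net gain; so `E`
carries no weight. -/
theorem eq_of_heavy_set {V : Type*} [Fintype V] {G H : SimpleGraph V} {D : ℕ}
    (hD : ∀ S, degSum G S ≤ D * #S) {x : V → ℝ} (hx0 : ∀ u, 0 ≤ x u)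
    (hquad : (∑ u, ∑ v, if G.Adj u v then x u * x v else 0) = lam G * ∑ u, x u ^ 2)
    {T : Finset V} (hTne : T.Nonempty) (hT : ∀ v ∈ T, 1 / 2 ≤ x v)
    (hT' : ∀ v ∉ T, x v ≤ 1 / (4 * (D + 2)))
    (hdeg : ∀ e ∉ T, #{y ∈ ({w | ∀ v ∈ T, G.Adj w v} : Finset V) | G.Adj e y} ≤ 2)
    (hHT : ∀ u ∈ T, ∀ v, v ≠ u → H.Adj u v)
    (hHR : ∀ a b, (∀ v ∈ T, G.Adj a v) → (∀ v ∈ T, G.Adj b v) → G.Adj a b → H.Adj a b)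
    (hlam : lam H ≤ lam G) : G = H := by
  obtain ⟨η, hη⟩ : ∃ η : ℝ, η = 1 / (4 * (D + 2)) := ⟨_, rfl⟩
  have hη0 : 0 < η := by rw [hη]; positivity
  have hηD : η * (D + 2) = 1 / 4 := by rw [hη]; field_simp
  rw [← hη] at hT'
  obtain ⟨R, hR⟩ : ∃ R : Finset V, R = ({w | ∀ v ∈ T, G.Adj w v} : Finset V) := ⟨_, rfl⟩
  have memR : ∀ w, w ∈ R ↔ ∀ v ∈ T, G.Adj w v := fun w => by simp [hR]
  rw [← hR] at hdeg
  have hRT : ∀ w ∈ R, w ∉ T := fun w hw hw' => ((memR w).1 hw w hw').ne rfl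
  obtain ⟨E, hE⟩ : ∃ E : Finset V, E = ({w | w ∉ T ∧ w ∉ R} : Finset V) := ⟨_, rfl⟩
  have memE : ∀ w, w ∈ E ↔ w ∉ T ∧ w ∉ R := fun w => by simp [hE]
  have hmiss : ∀ e, ∃ v, e ∈ E → v ∈ T ∧ ¬ G.Adj e v := by
    intro e
    by_cases he : e ∈ E
    · have h1 := ((memE e).1 he).2
      rw [memR] at h1
      push Not at h1
      obtain ⟨v, hv, hev⟩ := h1
      exact ⟨v, fun _ => ⟨hv, hev⟩⟩
    · exact ⟨e, fun h => absurd h he⟩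
  choose m hm using hmiss
  have hxx : ∀ u v, 0 ≤ x u * x v := fun u v => mul_nonneg (hx0 u) (hx0 v)
  have hHE : ∀ u v, G.Adj u v → u ∉ E → v ∉ E → H.Adj u v := by
    intro u v huv hu hv
    by_cases huT : u ∈ T
    · exact hHT u huT v huv.ne'
    by_cases hvT : v ∈ T
    · exact (hHT v hvT u huv.ne).symm
    rw [memE] at hu hv
    have huR : u ∈ R := by tauto
    have hvR : v ∈ R := by tauto
    exact hHR u v ((memR u).1 huR) ((memR v).1 hvR) huv
  -- An edge of `G` absent from `H` meets `E` and avoids `T`; the pairs `e, m e` are edges of `H`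
  -- but not of `G`. Both orientations are counted.
  have hpt : ∀ u v, (if G.Adj u v then x u * x v else 0) +
      (if u ∈ E ∧ v = m u then x u * x v else 0) + (if v ∈ E ∧ u = m v then x u * x v else 0) ≤
      (if H.Adj u v then x u * x v else 0) +
      (if u ∈ E ∧ v ∈ E ∧ G.Adj u v then x u * x v else 0) +
      (if u ∈ E ∧ v ∈ R ∧ G.Adj u v then x u * x v else 0) +
      (if v ∈ E ∧ u ∈ R ∧ G.Adj v u then x u * x v else 0) := by
    intro u v
    have h0 := hxx u v
    have n1 (p : Prop) [Decidable p] : 0 ≤ if p then x u * x v else 0 := by split_ifs <;> simp [h0]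
    by_cases h1 : u ∈ E ∧ v = m u
    · obtain ⟨hvT, huv⟩ := hm u h1.1
      rw [← h1.2] at hvT huv
      have h2 : ¬ (v ∈ E ∧ u = m v) := fun h => ((memE v).1 h.1).1 hvT
      have h3 : H.Adj u v := (hHT v hvT u fun e => ((memE u).1 h1.1).1 (e ▸ hvT)).symm
      rw [if_neg huv, if_pos h1, if_neg h2, if_pos h3]
      linarith [n1 (u ∈ E ∧ v ∈ E ∧ G.Adj u v), n1 (u ∈ E ∧ v ∈ R ∧ G.Adj u v),
        n1 (v ∈ E ∧ u ∈ R ∧ G.Adj v u)]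
    by_cases h2 : v ∈ E ∧ u = m v
    · obtain ⟨huT, hvu⟩ := hm v h2.1
      rw [← h2.2] at huT hvu
      have h3 : H.Adj u v := hHT u huT v fun e => ((memE v).1 h2.1).1 (e ▸ huT)
      rw [if_neg fun h : G.Adj u v => hvu h.symm, if_neg h1, if_pos h2, if_pos h3]
      linarith [n1 (u ∈ E ∧ v ∈ E ∧ G.Adj u v), n1 (u ∈ E ∧ v ∈ R ∧ G.Adj u v),
        n1 (v ∈ E ∧ u ∈ R ∧ G.Adj v u)]
    rw [if_neg h1, if_neg h2, add_zero, add_zero]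
    by_cases hG : G.Adj u v
    · rw [if_pos hG]
      by_cases hH : H.Adj u v
      · rw [if_pos hH]
        linarith [n1 (u ∈ E ∧ v ∈ E ∧ G.Adj u v), n1 (u ∈ E ∧ v ∈ R ∧ G.Adj u v),
          n1 (v ∈ E ∧ u ∈ R ∧ G.Adj v u)]
      · have huT : u ∉ T := fun h => hH (hHT u h v hG.ne')
        have hvT : v ∉ T := fun h => hH (hHT v h u hG.ne).symm
        have h3 : (u ∈ E ∧ v ∈ E ∧ G.Adj u v) ∨ (u ∈ E ∧ v ∈ R ∧ G.Adj u v) ∨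
            (v ∈ E ∧ u ∈ R ∧ G.Adj v u) := by
          have h4 := mt (hHE u v hG)
          have hvu := hG.symm
          have h5 := memE u
          have h6 := memE v
          tauto
        rcases h3 with h3 | h3 | h3
        · rw [if_pos h3]
          linarith [n1 (H.Adj u v), n1 (u ∈ E ∧ v ∈ R ∧ G.Adj u v),
            n1 (v ∈ E ∧ u ∈ R ∧ G.Adj v u)]
        · rw [if_pos h3]
          linarith [n1 (H.Adj u v), n1 (u ∈ E ∧ v ∈ E ∧ G.Adj u v),
            n1 (v ∈ E ∧ u ∈ R ∧ G.Adj v u)]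
        · rw [if_pos h3]
          linarith [n1 (H.Adj u v), n1 (u ∈ E ∧ v ∈ E ∧ G.Adj u v),
            n1 (u ∈ E ∧ v ∈ R ∧ G.Adj u v)]
    · rw [if_neg hG]
      linarith [n1 (H.Adj u v), n1 (u ∈ E ∧ v ∈ E ∧ G.Adj u v), n1 (u ∈ E ∧ v ∈ R ∧ G.Adj u v),
        n1 (v ∈ E ∧ u ∈ R ∧ G.Adj v u)]
  have hsum := sum_le_sum fun u (_ : u ∈ univ) => sum_le_sum fun v (_ : v ∈ univ) => hpt u v
  simp only [sum_add_distrib] at hsum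
  have hgain : (∑ e ∈ E, x e) / 2 ≤ ∑ u, ∑ v, if u ∈ E ∧ v = m u then x u * x v else 0 := by
    simp only [ite_and, sum_ite_irrel, sum_const_zero, sum_ite_eq', mem_univ, if_true]
    rw [sum_ite_mem, univ_inter, sum_div]
    refine sum_le_sum fun e he => ?_
    have := mul_le_mul_of_nonneg_left (hT _ (hm e he).1) (hx0 e)
    linarith
  have hgain' : (∑ u, ∑ v, if v ∈ E ∧ u = m v then x u * x v else 0) =
      ∑ u, ∑ v, if u ∈ E ∧ v = m u then x u * x v else 0 := by
    rw [sum_comm]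
    exact sum_congr rfl fun u _ => sum_congr rfl fun v _ => by rw [mul_comm]
  have hEE : (∑ u, ∑ v, if u ∈ E ∧ v ∈ E ∧ G.Adj u v then x u * x v else 0) ≤
      2 * D * η * ∑ e ∈ E, x e := by
    refine le_trans (le_of_eq ?_)
      (sum_sum_adj_le hD hx0 hη0.le E fun u hu => hT' u ((memE u).1 hu).1)
    simp only [ite_and, sum_ite_irrel, sum_const_zero, sum_ite_mem, univ_inter]
  have hER : (∑ u, ∑ v, if u ∈ E ∧ v ∈ R ∧ G.Adj u v then x u * x v else 0) ≤
      2 * η * ∑ e ∈ E, x e := by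
    simp only [ite_and, sum_ite_irrel, sum_const_zero, sum_ite_mem, univ_inter]
    rw [mul_sum]
    refine sum_le_sum fun e he => ?_
    rw [← sum_filter, ← mul_sum, mul_comm]
    refine mul_le_mul_of_nonneg_right ?_ (hx0 e)
    calc ∑ v ∈ R with G.Adj e v, x v ≤ ∑ v ∈ R with G.Adj e v, η :=
          sum_le_sum fun v hv => hT' v (hRT v (mem_filter.1 hv).1)
      _ = #{v ∈ R | G.Adj e v} * η := by rw [sum_const, nsmul_eq_mul]
      _ ≤ 2 * η := by
        refine mul_le_mul_of_nonneg_right ?_ hη0.le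
        exact_mod_cast hdeg e ((memE e).1 he).1
  have hRE : (∑ u, ∑ v, if v ∈ E ∧ u ∈ R ∧ G.Adj v u then x u * x v else 0) =
      ∑ u, ∑ v, if u ∈ E ∧ v ∈ R ∧ G.Adj u v then x u * x v else 0 := by
    rw [sum_comm]
    exact sum_congr rfl fun u _ => sum_congr rfl fun v _ => by rw [mul_comm]
  rw [hgain', hRE] at hsum
  have hE0 : 0 ≤ ∑ e ∈ E, x e := sum_nonneg fun e _ => hx0 e
  -- The value of `η` is chosen for this: the total loss is half of the guaranteed gain `∑ e ∈ E, x
  -- e`.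
  have hbound : 2 * D * η * ∑ e ∈ E, x e + 2 * (2 * η * ∑ e ∈ E, x e) = (∑ e ∈ E, x e) / 2 := by
    have : 2 * D * η * ∑ e ∈ E, x e + 2 * (2 * η * ∑ e ∈ E, x e) =
      2 * (η * (D + 2)) * ∑ e ∈ E, x e := by ring
    rw [this, hηD]
    ring
  have hHq := quadForm_le_lam H x
  have hsq : lam H * ∑ u, x u ^ 2 ≤ lam G * ∑ u, x u ^ 2 :=
    mul_le_mul_of_nonneg_right hlam (sum_nonneg fun _ _ => sq_nonneg _)
  have hEsum : ∑ e ∈ E, x e = 0 := by linarith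
  have heig := eigenvector_of_quadForm_eq H x (by linarith)
  -- As `x` is now an eigenvector of `H` too, a zero entry outside `T` would force its neighbours in
  -- `T` to have weight zero. Positivity then empties `E`, giving `G ≤ H` and equality.
  have hpos : ∀ u, 0 < x u := by
    intro u
    by_cases huT : u ∈ T
    · linarith [hT u huT]
    obtain ⟨v, hv⟩ := hTne
    refine (hx0 u).lt_of_ne fun h0 => ?_
    have h1 := heig u
    rw [← h0, mul_zero] at h1
    have h2 := (sum_eq_zero_iff_of_nonneg fun w _ => hx0 w).1 h1 v
      (mem_filter.2 ⟨mem_univ v, (hHT v hv u fun e => huT (e ▸ hv)).symm⟩)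
    linarith [hT v hv]
  have hEe : ∀ u, u ∉ E := fun u hu =>
    (hpos u).ne' ((sum_eq_zero_iff_of_nonneg fun w _ => hx0 w).1 hEsum u hu)
  exact adj_eq_of_quadForm_eq (fun u v huv => hHE u v huv (hEe u) (hEe v)) x hpos (by linarith)

end Comparison

/-! ### The target graphs: spectral bound, minor freeness, embedding a matching -/

section Targets

open scoped Classical
open Finset

theorem join_adj_inl_inl {V W : Type*} (G : SimpleGraph V) (H : SimpleGraph W) (a b : V) :
    (join G H).Adj (Sum.inl a) (Sum.inl b) ↔ G.Adj a b := by
  simp [join]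

theorem join_adj_inr_inr {V W : Type*} (G : SimpleGraph V) (H : SimpleGraph W) (a b : W) :
    (join G H).Adj (Sum.inr a) (Sum.inr b) ↔ H.Adj a b := by
  simp [join]

theorem join_adj_inl_inr {V W : Type*} (G : SimpleGraph V) (H : SimpleGraph W) (a : V) (b : W) :
    (join G H).Adj (Sum.inl a) (Sum.inr b) := by
  simp [join]

theorem join_top_adj_inl {V W : Type*} (H : SimpleGraph W) (a : V) (b : V ⊕ W)
    (hab : b ≠ Sum.inl a) : (join (⊤ : SimpleGraph V) H).Adj (Sum.inl a) b := by
  rcases b with b | b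
  · rw [join_adj_inl_inl, SimpleGraph.top_adj]
    exact fun e => hab (by rw [e])
  · exact join_adj_inl_inr _ _ _ _

/-- Rayleigh quotient at the Perron vector of the complete bipartite graph between `T` and its
complement. -/
theorem sq_lam_ge {V : Type*} [Fintype V] (H : SimpleGraph V) (T : Finset V)
    (hHT : ∀ u ∈ T, ∀ v, v ≠ u → H.Adj u v) :
    (#T : ℝ) * (Fintype.card V - #T) ≤ lam H ^ 2 := by
  have hc : (#Tᶜ : ℝ) = Fintype.card V - #T := by
    rw [card_compl, Nat.cast_sub (card_le_univ _)]
  rw [← hc]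
  set p : ℝ := (#T : ℝ) with hp
  set q : ℝ := (#Tᶜ : ℝ) with hq
  have hp0 : 0 ≤ p := Nat.cast_nonneg _
  have hq0 : 0 ≤ q := Nat.cast_nonneg _
  rcases (mul_nonneg hp0 hq0).eq_or_lt with h0 | h0
  · rw [← h0]
    exact sq_nonneg _
  let x : V → ℝ := fun u => if u ∈ T then √q else √p
  have hx : ∀ u, 0 ≤ x u := fun u => by
    simp only [x]
    split_ifs <;> exact Real.sqrt_nonneg _
  have hxT : ∀ u ∈ T, x u = √q := fun u hu => if_pos hu
  have hxT' : ∀ u ∈ Tᶜ, x u = √p := fun u hu => if_neg (mem_compl.1 hu)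
  have h1 := quadForm_le_lam H x
  have hsq : ∑ u, x u ^ 2 = 2 * (p * q) := by
    rw [← sum_add_sum_compl T, sum_congr rfl fun u hu => by rw [hxT u hu, Real.sq_sqrt hq0],
      sum_congr rfl fun u (hu : u ∈ Tᶜ) => by rw [hxT' u hu, Real.sq_sqrt hp0], sum_const,
      sum_const, nsmul_eq_mul, nsmul_eq_mul, ← hp, ← hq]
    ring
  have hnn : ∀ u v, 0 ≤ if H.Adj u v then x u * x v else 0 := fun u v => by
    split_ifs
    · exact mul_nonneg (hx u) (hx v)
    · exact le_rfl
  have hA : p * (q * (√p * √q)) ≤ ∑ u ∈ T, ∑ v, if H.Adj u v then x u * x v else 0 := by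
    rw [hp, ← nsmul_eq_mul, ← sum_const]
    refine sum_le_sum fun u hu => ?_
    refine le_trans ?_ (sum_le_sum_of_subset_of_nonneg (subset_univ Tᶜ) fun v _ _ => hnn u v)
    rw [hq, ← nsmul_eq_mul, ← sum_const]
    refine sum_le_sum fun v hv => ?_
    rw [if_pos (hHT u hu v fun e => mem_compl.1 hv (e ▸ hu)), hxT u hu, hxT' v hv, mul_comm]
  have hB : q * (p * (√p * √q)) ≤ ∑ u ∈ Tᶜ, ∑ v, if H.Adj u v then x u * x v else 0 := by
    rw [hq, ← nsmul_eq_mul, ← sum_const]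
    refine sum_le_sum fun u hu => ?_
    refine le_trans ?_ (sum_le_sum_of_subset_of_nonneg (subset_univ T) fun v _ _ => hnn u v)
    rw [hp, ← nsmul_eq_mul, ← sum_const]
    refine sum_le_sum fun v hv => ?_
    rw [if_pos (hHT v hv u fun e => mem_compl.1 hu (e ▸ hv)).symm, hxT v hv, hxT' u hu]
  rw [← sum_add_sum_compl T, hsq] at h1
  have h2 : √p * √q ≤ lam H := by
    refine le_of_mul_le_mul_right ?_ (show 0 < 2 * (p * q) by linarith)
    linarith
  calc p * q = (√p * √q) ^ 2 := by rw [mul_pow, Real.sq_sqrt hp0, Real.sq_sqrt hq0]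
    _ ≤ lam H ^ 2 := pow_le_pow_left₀ (by positivity) h2 2

/-- In a minor model of a graph on `t + 3` vertices in a join with left part of size `t`, three
branch sets lie in the right part. -/
theorem exists_three_right {t : ℕ} {W : Type*} (B : Fin (t + 3) → Set (Fin t ⊕ W))
    (hB : ∀ u v, u ≠ v → Disjoint (B u) (B v)) :
    ∃ a b c, a ≠ b ∧ a ≠ c ∧ b ≠ c ∧ (∀ x ∈ B a, ∃ y, x = Sum.inr y) ∧
      (∀ x ∈ B b, ∃ y, x = Sum.inr y) ∧ ∀ x ∈ B c, ∃ y, x = Sum.inr y := by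
  have h : #({w | ∃ i, Sum.inl i ∈ B w} : Finset (Fin (t + 3))) ≤ t := by
    have hex : ∀ w : ({w | ∃ i, Sum.inl i ∈ B w} : Finset (Fin (t + 3))),
        ∃ i, Sum.inl i ∈ B w := fun w => (mem_filter.1 w.2).2
    choose f hf using hex
    have hinj : Function.Injective f := by
      intro u v huv
      by_contra hne
      exact Set.disjoint_left.1 (hB u v fun e => hne (Subtype.ext e)) (hf u) (huv ▸ hf v)
    have h1 := Fintype.card_le_of_injective f hinj
    rwa [Fintype.card_coe, Fintype.card_fin] at h1
  have h2 := card_add_card_compl ({w | ∃ i, Sum.inl i ∈ B w} : Finset (Fin (t + 3)))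
  rw [Fintype.card_fin] at h2
  obtain ⟨a, ha, b, hb, c, hc, hab, hac, hbc⟩ := two_lt_card.1
    (show 2 < #({w | ∃ i, Sum.inl i ∈ B w} : Finset (Fin (t + 3)))ᶜ by omega)
  have key : ∀ w ∈ ({w | ∃ i, Sum.inl i ∈ B w} : Finset (Fin (t + 3)))ᶜ,
      ∀ x ∈ B w, ∃ y, x = Sum.inr y := by
    intro w hw x hx
    rw [mem_compl, mem_filter] at hw
    rcases x with i | y
    · exact absurd ⟨mem_univ _, i, hx⟩ hw
    · exact ⟨y, rfl⟩
  exact ⟨a, b, c, hab, hac, hbc, key a ha, key b hb, key c hc⟩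

theorem minorFree_splitGraph {t n : ℕ} {F : SimpleGraph (Fin (t + 3))}
    (hF : ∀ a b c, a ≠ b → a ≠ c → b ≠ c → F.Adj a b ∨ F.Adj a c ∨ F.Adj b c) :
    MinorFree F (splitGraph n t) := by
  rintro ⟨B, -, hd, ha⟩
  obtain ⟨a, b, c, hab, hac, hbc, Ba, Bb, Bc⟩ := exists_three_right B hd
  have key : ∀ u v, (∀ x ∈ B u, ∃ y, x = Sum.inr y) → (∀ x ∈ B v, ∃ y, x = Sum.inr y) →
      ¬ F.Adj u v := by
    intro u v hu hv huv
    obtain ⟨x, hx, y, hy, hxy⟩ := ha u v huv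
    obtain ⟨x, rfl⟩ := hu x hx
    obtain ⟨y, rfl⟩ := hv y hy
    rw [splitGraph, join_adj_inr_inr] at hxy
    exact hxy
  rcases hF a b c hab hac hbc with h | h | h
  · exact key a b Ba Bb h
  · exact key a c Ba Bc h
  · exact key b c Bb Bc h

theorem eq_of_reachable {V α : Type*} {G : SimpleGraph V} {f : V → α}
    (hf : ∀ u v, G.Adj u v → f u = f v) {u v : V} (h : G.Reachable u v) : f u = f v := by
  obtain ⟨p⟩ := h
  induction p with
  | nil => rfl
  | cons h _ ih => exact (hf _ _ h).trans ih

theorem edgesAndPoints_adj {p q : ℕ} {x y : (Fin p × Fin 2) ⊕ Fin q} :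
    (edgesAndPoints p q).Adj x y ↔
      ∃ i j j', j ≠ j' ∧ x = Sum.inl (i, j) ∧ y = Sum.inl (i, j') := by
  rcases x with ⟨i, j⟩ | x <;> rcases y with ⟨i', j'⟩ | y
  · have key : (edgesAndPoints p q).Adj (Sum.inl (i, j)) (Sum.inl (i', j')) ↔ j ≠ j' ∧ i = i' := by
      simp [edgesAndPoints, SimpleGraph.boxProd_adj]
    rw [key]
    constructor
    · rintro ⟨h, rfl⟩
      exact ⟨i, j, j', h, rfl, rfl⟩
    · rintro ⟨a, b, c, h, e1, e2⟩
      obtain ⟨rfl, rfl⟩ := Prod.mk.inj (Sum.inl.inj e1)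
      obtain ⟨rfl, rfl⟩ := Prod.mk.inj (Sum.inl.inj e2)
      exact ⟨h, rfl⟩
  all_goals simp [edgesAndPoints]

/-- Two of any three vertex pairs of `F` are edges, so one of the three branch sets in the matching
part touches both others. Being connected, it lies in one component, which has at most two vertices.
-/
theorem minorFree_friendshipGraph {t n : ℕ} {F : SimpleGraph (Fin (t + 3))}
    (hF : ∀ a b c, a ≠ b → a ≠ c → b ≠ c → F.Adj a b ∨ F.Adj a c) :
    MinorFree F (friendshipGraph n t) := by
  rintro ⟨B, hcon, hd, ha⟩
  obtain ⟨a, b, c, hab, hac, hbc, Ba, Bb, Bc⟩ := exists_three_right B hd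
  -- Labels each vertex of the right part by its component.
  let f : Fin t ⊕ ((Fin ((n - t) / 2) × Fin 2) ⊕ Fin ((n - t) % 2)) →
      Option (Fin ((n - t) / 2) ⊕ Fin ((n - t) % 2)) :=
    Sum.elim (fun _ => none) fun z => some (Sum.map Prod.fst id z)
  have main : ∀ a b c, b ≠ c → a ≠ c → (∀ x ∈ B a, ∃ y, x = Sum.inr y) →
      (∀ x ∈ B b, ∃ y, x = Sum.inr y) → (∀ x ∈ B c, ∃ y, x = Sum.inr y) →
      F.Adj a b → F.Adj a c → False := by
    intro a b c hbc hac Ba Bb Bc fab fac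
    obtain ⟨x, hx, y, hy, hxy⟩ := ha a b fab
    obtain ⟨x', hx', z, hz, hxz⟩ := ha a c fac
    have hfx : f x = f x' := by
      refine eq_of_reachable (f := fun w : B a => f w) ?_ ((hcon a).preconnected ⟨x, hx⟩ ⟨x', hx'⟩)
      rintro ⟨u, hu⟩ ⟨v, hv⟩ huv
      obtain ⟨u, rfl⟩ := Ba u hu
      obtain ⟨v, rfl⟩ := Ba v hv
      rw [SimpleGraph.induce_adj, friendshipGraph, join_adj_inr_inr, edgesAndPoints_adj] at huv
      obtain ⟨i, j, j', -, rfl, rfl⟩ := huv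
      rfl
    have hyc : y ≠ z := fun e => Set.disjoint_left.1 (hd b c hbc) hy (e ▸ hz)
    have hxc : x ≠ z := fun e => Set.disjoint_left.1 (hd a c hac) hx (e ▸ hz)
    obtain ⟨x, rfl⟩ := Ba x hx
    obtain ⟨x', rfl⟩ := Ba x' hx'
    obtain ⟨y, rfl⟩ := Bb y hy
    obtain ⟨z, rfl⟩ := Bc z hz
    rw [friendshipGraph, join_adj_inr_inr, edgesAndPoints_adj] at hxy hxz
    obtain ⟨i, j, j', hj, rfl, rfl⟩ := hxy
    obtain ⟨i', k, k', hk, rfl, rfl⟩ := hxz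
    have hi : i = i' := by simpa [f] using hfx
    subst hi
    simp only [ne_eq, Sum.inr.injEq, Sum.inl.injEq, Prod.mk.injEq, true_and] at hyc hxc
    omega
  rcases hF a b c hab hac hbc with h1 | h1
  · rcases hF c a b hac.symm hbc.symm hab with h2 | h2
    · exact main a b c hbc hac Ba Bb Bc h1 h2.symm
    · exact main b a c hac hbc Bb Ba Bc h1.symm h2.symm
  · rcases hF b a c hab.symm hbc hac with h2 | h2
    · exact main a c b hbc.symm hab Ba Bc Bb h1 h2.symm
    · exact main c a b hab hbc.symm Bc Ba Bb h1.symm h2.symm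

/-- Numbers the vertices so that matched vertices receive `2i` and `2i + 1`. Two vertices are
removed at each step: an edge, or any two once no edges are left. -/
theorem exists_pairing (m : ℕ) : ∀ {W : Type} [Fintype W] (M : SimpleGraph W),
    Fintype.card W = m → (∀ a b c, M.Adj a b → M.Adj a c → b = c) →
    ∃ f : W → ℕ, Function.Injective f ∧ (∀ w, f w < m) ∧
      ∀ a b, M.Adj a b → f a / 2 = f b / 2 := by
  induction m using Nat.strong_induction_on with
  | _ m ih =>
  intro W _ M hm hM
  rcases Nat.lt_or_ge m 2 with h2 | h2
  · have hs : Subsingleton W := Fintype.card_le_one_iff_subsingleton.1 (by omega)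
    refine ⟨fun _ => 0, fun a b _ => Subsingleton.elim a b, fun w => ?_, fun _ _ _ => rfl⟩
    rw [← hm]
    exact Fintype.card_pos_iff.2 ⟨w⟩
  obtain ⟨u, v, huv, hu, hv⟩ : ∃ u v, u ≠ v ∧ (∀ w, M.Adj u w → w = v) ∧
      ∀ w, M.Adj v w → w = u := by
    by_cases h : ∃ u v, M.Adj u v
    · obtain ⟨u, v, h⟩ := h
      exact ⟨u, v, h.ne, fun w hw => hM u w v hw h, fun w hw => hM v w u hw h.symm⟩
    · push Not at h
      obtain ⟨u, v, huv⟩ := Fintype.one_lt_card_iff.1 (show 1 < Fintype.card W by omega)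
      exact ⟨u, v, huv, fun w hw => absurd hw (h _ _), fun w hw => absurd hw (h _ _)⟩
  have hc : Fintype.card {w // w ∉ ({u, v} : Finset W)} = m - 2 := by
    rw [Fintype.card_subtype_compl, hm, Fintype.card_coe, card_pair huv]
  obtain ⟨f, hf, hfm, hfa⟩ := ih (m - 2) (by omega)
    (M.comap (Subtype.val : {w // w ∉ ({u, v} : Finset W)} → W)) hc
    fun a b c hab hac => Subtype.ext (hM a b c hab hac)
  let g : W → ℕ := fun w => if w = u then 0 else if w = v then 1 else
    if h : w ∉ ({u, v} : Finset W) then f ⟨w, h⟩ + 2 else 0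
  have gu : g u = 0 := if_pos rfl
  have gv : g v = 1 := by simp [g, huv.symm]
  have go : ∀ w (h : w ∉ ({u, v} : Finset W)), g w = f ⟨w, h⟩ + 2 := by
    intro w h
    have h' := h
    simp only [mem_insert, mem_singleton, not_or] at h'
    simp only [g]
    rw [if_neg h'.1, if_neg h'.2, dif_pos h]
  have hcases : ∀ w, w = u ∨ w = v ∨ w ∉ ({u, v} : Finset W) := by
    intro w
    simp only [mem_insert, mem_singleton]
    tauto
  refine ⟨g, ?_, ?_, ?_⟩
  · intro a b hab
    rcases hcases a with rfl | rfl | ha <;> rcases hcases b with rfl | rfl | hb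
    · rfl
    · omega
    · rw [gu, go b hb] at hab
      omega
    · omega
    · rfl
    · rw [gv, go b hb] at hab
      omega
    · rw [gu, go a ha] at hab
      omega
    · rw [gv, go a ha] at hab
      omega
    · rw [go a ha, go b hb] at hab
      exact congrArg Subtype.val (hf (Nat.add_right_cancel hab))
  · intro w
    rcases hcases w with rfl | rfl | hw
    · omega
    · omega
    · rw [go w hw]
      have := hfm ⟨w, hw⟩
      omega
  · intro a b hab
    rcases hcases a with rfl | rfl | ha
    · rw [hu b hab, gu, gv]
    · rw [hv b hab, gu, gv]
    rcases hcases b with rfl | rfl | hb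
    · rw [hu a hab.symm, gu, gv]
    · rw [hv a hab.symm, gu, gv]
    · rw [go a ha, go b hb]
      have := hfa ⟨a, ha⟩ ⟨b, hb⟩ hab
      omega

theorem exists_equiv_edgesAndPoints {W : Type} [Fintype W] (M : SimpleGraph W)
    (hM : ∀ a b c, M.Adj a b → M.Adj a c → b = c) {m : ℕ} (hm : Fintype.card W = m) :
    ∃ e : W ≃ (Fin (m / 2) × Fin 2) ⊕ Fin (m % 2),
      ∀ a b, M.Adj a b → (edgesAndPoints (m / 2) (m % 2)).Adj (e a) (e b) := by
  obtain ⟨f, hf, hfm, hfa⟩ := exists_pairing m M hm hM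
  -- The second case arises only for the last number `m - 1` when `m` is odd.
  let g : W → (Fin (m / 2) × Fin 2) ⊕ Fin (m % 2) := fun w =>
    if h : f w / 2 < m / 2 then Sum.inl (⟨f w / 2, h⟩, ⟨f w % 2, Nat.mod_lt _ two_pos⟩)
    else Sum.inr ⟨0, by have := hfm w; omega⟩
  have gl : ∀ w (h : f w / 2 < m / 2),
      g w = Sum.inl (⟨f w / 2, h⟩, ⟨f w % 2, Nat.mod_lt _ two_pos⟩) := fun w h => dif_pos h
  have gr : ∀ w (h : ¬ f w / 2 < m / 2), g w = Sum.inr ⟨0, by have := hfm w; omega⟩ :=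
    fun w h => dif_neg h
  have hg : Function.Injective g := by
    intro a b hab
    apply hf
    have ha := hfm a
    have hb := hfm b
    by_cases h1 : f a / 2 < m / 2 <;> by_cases h2 : f b / 2 < m / 2
    · rw [gl a h1, gl b h2] at hab
      simp only [Sum.inl.injEq, Prod.mk.injEq, Fin.mk.injEq] at hab
      omega
    · rw [gl a h1, gr b h2] at hab
      exact absurd hab Sum.inl_ne_inr
    · rw [gr a h1, gl b h2] at hab
      exact absurd hab Sum.inr_ne_inl
    · omega
  refine ⟨Equiv.ofBijective g ((Fintype.bijective_iff_injective_and_card g).2 ⟨hg, ?_⟩), ?_⟩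
  · simp only [Fintype.card_sum, Fintype.card_prod, Fintype.card_fin, hm]
    omega
  · intro a b hab
    have h1 := hfa a b hab
    have hne : f a ≠ f b := fun e => hab.ne (hf e)
    have ha := hfm a
    have hb := hfm b
    have h2 : f a / 2 < m / 2 := by omega
    have h3 : f b / 2 < m / 2 := by omega
    simp only [Equiv.ofBijective_apply]
    rw [gl a h2, gl b h3, edgesAndPoints_adj]
    refine ⟨⟨f a / 2, h2⟩, ⟨f a % 2, Nat.mod_lt _ two_pos⟩, ⟨f b % 2, Nat.mod_lt _ two_pos⟩,
      ?_, rfl, ?_⟩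
    · rw [ne_eq, Fin.mk.injEq]
      omega
    · simp only [h1]

end Targets

/-! ### Nonadjacent pairs and triples in `F` -/

section CompleteMinusPaths

variable {r l : ℕ} {k : Fin l → ℕ} {φ : (Σ i, Fin (k i)) ↪ Fin r}

theorem not_adj_completeMinusPaths {a b : Fin r} (hab : a ≠ b) :
    ¬ (completeMinusPaths r k φ).Adj a b ↔
      ∃ (i : Fin l) (j j' : Fin (k i)), (j.val + 1 = j'.val ∨ j'.val + 1 = j.val) ∧
        φ ⟨i, j⟩ = a ∧ φ ⟨i, j'⟩ = b := by
  simp only [completeMinusPaths, SimpleGraph.sdiff_adj, SimpleGraph.top_adj,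
    SimpleGraph.iSup_adj, SimpleGraph.map_adj, SimpleGraph.pathGraph_adj, not_and, not_not]
  exact ⟨fun h => h hab, fun h _ => h⟩

/-- Three pairwise nonadjacent vertices would lie on one path with pairwise consecutive positions,
which is impossible. -/
theorem completeMinusPaths_adj_of_three {a b c : Fin r} (hab : a ≠ b) (hac : a ≠ c)
    (hbc : b ≠ c) : (completeMinusPaths r k φ).Adj a b ∨ (completeMinusPaths r k φ).Adj a c ∨
      (completeMinusPaths r k φ).Adj b c := by
  by_contra hcon
  simp only [not_or] at hcon
  obtain ⟨h1, h2, h3⟩ := hcon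
  rw [not_adj_completeMinusPaths hab] at h1
  rw [not_adj_completeMinusPaths hac] at h2
  rw [not_adj_completeMinusPaths hbc] at h3
  obtain ⟨i, j, j', hj, rfl, rfl⟩ := h1
  obtain ⟨i', p, p', hp, e1, rfl⟩ := h2
  have e2 := φ.injective e1
  obtain ⟨rfl, e3⟩ := Sigma.mk.inj_iff.1 e2
  obtain rfl := eq_of_heq e3
  obtain ⟨i'', s, s', hs, e4, e5⟩ := h3
  obtain ⟨rfl, e6⟩ := Sigma.mk.inj_iff.1 (φ.injective e4)
  obtain rfl := eq_of_heq e6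
  obtain ⟨-, e7⟩ := Sigma.mk.inj_iff.1 (φ.injective e5)
  obtain rfl := eq_of_heq e7
  omega

theorem completeMinusPaths_adj_or (hk : ∀ i, k i = 2) {a b c : Fin r} (hab : a ≠ b)
    (hac : a ≠ c) (hbc : b ≠ c) :
    (completeMinusPaths r k φ).Adj a b ∨ (completeMinusPaths r k φ).Adj a c := by
  by_contra hcon
  simp only [not_or] at hcon
  obtain ⟨h1, h2⟩ := hcon
  rw [not_adj_completeMinusPaths hab] at h1
  rw [not_adj_completeMinusPaths hac] at h2
  obtain ⟨i, j, j', hj, rfl, rfl⟩ := h1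
  obtain ⟨i', p, p', hp, e1, rfl⟩ := h2
  obtain ⟨rfl, e3⟩ := Sigma.mk.inj_iff.1 (φ.injective e1)
  obtain rfl := eq_of_heq e3
  refine hbc (congrArg φ (congrArg (Sigma.mk _) (Fin.ext ?_)))
  have := hk i'
  have := p.2
  have := p'.2
  have := j'.2
  omega

theorem exists_not_adj {i : Fin l} (hi : 2 ≤ k i) :
    ∃ a b, a ≠ b ∧ ¬ (completeMinusPaths r k φ).Adj a b := by
  have hab : φ ⟨i, ⟨0, by omega⟩⟩ ≠ φ ⟨i, ⟨1, by omega⟩⟩ := by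
    intro e
    have := eq_of_heq (Sigma.mk.inj_iff.1 (φ.injective e)).2
    simp at this
  exact ⟨_, _, hab, (not_adj_completeMinusPaths hab).2 ⟨i, _, _, Or.inl rfl, rfl, rfl⟩⟩

theorem exists_not_adj_not_adj {i : Fin l} (hi : 3 ≤ k i) :
    ∃ a b c, a ≠ b ∧ a ≠ c ∧ b ≠ c ∧ ¬ (completeMinusPaths r k φ).Adj a b ∧
      ¬ (completeMinusPaths r k φ).Adj b c := by
  have hne : ∀ j j' : Fin (k i), j ≠ j' → φ ⟨i, j⟩ ≠ φ ⟨i, j'⟩ := fun j j' hj e =>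
    hj (eq_of_heq (Sigma.mk.inj_iff.1 (φ.injective e)).2)
  have hab := hne ⟨0, by omega⟩ ⟨1, by omega⟩ (by simp)
  have hac := hne ⟨0, by omega⟩ ⟨2, by omega⟩ (by simp)
  have hbc := hne ⟨1, by omega⟩ ⟨2, by omega⟩ (by simp)
  exact ⟨_, _, _, hab, hac, hbc, (not_adj_completeMinusPaths hab).2 ⟨i, _, _, Or.inl rfl, rfl, rfl⟩,
    (not_adj_completeMinusPaths hbc).2 ⟨i, _, _, Or.inl rfl, rfl, rfl⟩⟩

end CompleteMinusPaths

/-! ### Assembling the extremal statements -/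

section Extremal

open scoped Classical
open Finset

/-- For large `n`, an `F`-minor free graph of spectral radius at least that of `K_{t,n-t}` has a
set `T` of `t` vertices such that it equals every graph of no larger spectral radius in which the
vertices of `T` dominate and which contains the edges between common neighbours of `T`. -/
theorem exists_dominating_core {t : ℕ} (ht : 1 ≤ t) (F : SimpleGraph (Fin (t + 3)))
    {a b : Fin (t + 3)} (hab : a ≠ b) (nab : ¬ F.Adj a b) :
    ∃ N : ℕ, ∀ (V : Type) [Fintype V] (G : SimpleGraph V), N ≤ Fintype.card V → MinorFree F G →
      (t : ℝ) * (Fintype.card V - t) ≤ lam G ^ 2 →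
      ∃ T R : Finset V, #T = t ∧ t + 4 ≤ #R ∧ (∀ w, w ∈ R ↔ ∀ v ∈ T, G.Adj w v) ∧
        ∀ H : SimpleGraph V, (∀ u ∈ T, ∀ v, v ≠ u → H.Adj u v) →
          (∀ c ∈ R, ∀ d ∈ R, G.Adj c d → H.Adj c d) → lam H ≤ lam G → G = H := by
  obtain ⟨N, hN⟩ := exists_heavy_set t (2 ^ (t + 3)) (t + 3) ht Nat.one_le_two_pow
  refine ⟨N + 2 * t + 8, fun V _ G hn hG hlam => ?_⟩
  have : Nonempty V := Fintype.card_pos_iff.1 (by omega)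
  obtain ⟨x, hx0, hx1, hxm, heig, hquad⟩ := exists_perron G
  have hD := degSum_le_of_minorFree hG
  obtain ⟨T, hTt, hT, hT', hc⟩ := hN V G x (by omega) hD
    (fun T R hT hR => card_common_le hG hab nab hT hR) hlam hx0 hx1 hxm heig
  have hR : t + 4 ≤ #{w | ∀ v ∈ T, G.Adj w v} := by omega
  refine ⟨T, ({w | ∀ v ∈ T, G.Adj w v} : Finset V), hTt, hR, fun w => by simp,
    fun H hHT hHR hl => ?_⟩
  refine eq_of_heavy_set hD hx0 hquad (card_pos.1 (by omega)) hT hT' (fun e he => ?_) hHT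
    (fun c d hc hd hcd => hHR c (by simpa using hc) d (by simpa using hd) hcd) hl
  exact card_adj_common_le hG hab nab hTt (fun w hw => (mem_filter.1 hw).2) hR he

/-- Arrange a `t`-set as the left part and the remaining vertices as prescribed on the right. -/
theorem exists_equiv_sum {n t : ℕ} {W : Type*} (T : Finset (Fin n)) (hT : #T = t)
    (e : {v // v ∉ T} ≃ W) :
    ∃ f : Fin n ≃ Fin t ⊕ W, (∀ v ∈ T, ∃ i, f v = Sum.inl i) ∧
      ∀ v (hv : v ∉ T), f v = Sum.inr (e ⟨v, hv⟩) := by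
  refine ⟨(Equiv.sumCompl (· ∈ T)).symm.trans (Equiv.sumCongr (T.equivFinOfCardEq hT) e),
    fun v hv => ?_, fun v hv => ?_⟩
  · rw [Equiv.trans_apply, Equiv.sumCompl_symm_apply_of_pos hv]
    exact ⟨_, rfl⟩
  · rw [Equiv.trans_apply, Equiv.sumCompl_symm_apply_of_neg hv]
    rfl

theorem sq_lam_join_ge {n t : ℕ} (htn : t ≤ n) {W : Type*} [Fintype W] (H : SimpleGraph W)
    (hW : Fintype.card W = n - t) :
    (t : ℝ) * (n - t) ≤ lam (join (⊤ : SimpleGraph (Fin t)) H) ^ 2 := by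
  have h := sq_lam_ge (join (⊤ : SimpleGraph (Fin t)) H) (univ.map Function.Embedding.inl)
    fun u hu v hv => by
      obtain ⟨i, -, rfl⟩ := mem_map.1 hu
      exact join_top_adj_inl H i v hv
  rw [card_map, card_univ, Fintype.card_sum, Fintype.card_fin, hW, Nat.add_sub_cancel' htn] at h
  exact h

theorem iso_of_lam_ge {n t : ℕ} {W : Type*} [Fintype W] (H : SimpleGraph W)
    {G : SimpleGraph (Fin n)} {T R : Finset (Fin n)} (hT : #T = t)
    (hR : ∀ w, w ∈ R ↔ ∀ v ∈ T, G.Adj w v)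
    (hGH : ∀ H : SimpleGraph (Fin n), (∀ u ∈ T, ∀ v, v ≠ u → H.Adj u v) →
      (∀ c ∈ R, ∀ d ∈ R, G.Adj c d → H.Adj c d) → lam H ≤ lam G → G = H)
    (e : {v // v ∉ T} ≃ W)
    (he : ∀ c d : {v // v ∉ T}, c.1 ∈ R → d.1 ∈ R → G.Adj c d → H.Adj (e c) (e d))
    (hlam : lam (join (⊤ : SimpleGraph (Fin t)) H) ≤ lam G) :
    Nonempty (G ≃g join (⊤ : SimpleGraph (Fin t)) H) := by
  obtain ⟨f, hf, hf'⟩ := exists_equiv_sum T hT e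
  have hRT : ∀ w ∈ R, w ∉ T := fun w hw hw' => ((hR w).1 hw w hw').ne rfl
  have iso := SimpleGraph.Iso.comap f (join (⊤ : SimpleGraph (Fin t)) H)
  have hG := hGH ((join (⊤ : SimpleGraph (Fin t)) H).comap f) (fun u hu v hv => ?_)
    (fun c hc d hd hcd => ?_) ((lam_congr iso).trans_le hlam)
  · rw [hG]
    exact ⟨iso⟩
  · obtain ⟨i, hi⟩ := hf u hu
    rw [SimpleGraph.comap_adj, hi]
    exact join_top_adj_inl H i _ fun h => hv (f.injective (h.trans hi.symm))
  · rw [SimpleGraph.comap_adj, hf' c (hRT c hc), hf' d (hRT d hd), join_adj_inr_inr]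
    exact he ⟨c, hRT c hc⟩ ⟨d, hRT d hd⟩ hc hd hcd

/-- Isomorphic graphs have equal spectral radius, so the one implication excludes `lam G > lam H`
and settles equality at once. -/
theorem lam_le_and_eq_iff {V W : Type*} [Fintype V] [Fintype W] {G : SimpleGraph V}
    {H : SimpleGraph W} (h : lam H ≤ lam G → Nonempty (G ≃g H)) :
    lam G ≤ lam H ∧ (lam G = lam H ↔ Nonempty (G ≃g H)) := by
  refine ⟨?_, fun e => h e.ge, fun ⟨e⟩ => lam_congr e⟩
  by_contra hcon
  obtain ⟨e⟩ := h (not_le.1 hcon).le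
  exact hcon (lam_congr e).le

theorem card_notMem {n t : ℕ} {T : Finset (Fin n)} (hT : #T = t) :
    Fintype.card {v // v ∉ T} = n - t := by
  rw [Fintype.card_subtype_compl, Fintype.card_fin, Fintype.card_coe, hT]

theorem extremal_friendshipGraph {t : ℕ} (ht : 1 ≤ t) (F : SimpleGraph (Fin (t + 3)))
    {a b : Fin (t + 3)} (hab : a ≠ b) (nab : ¬ F.Adj a b) :
    ∃ N : ℕ, ∀ n ≥ N, ∀ G : SimpleGraph (Fin n), MinorFree F G →
      lam G ≤ lam (friendshipGraph n t) ∧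
        (lam G = lam (friendshipGraph n t) ↔ Nonempty (G ≃g friendshipGraph n t)) := by
  obtain ⟨N, hN⟩ := exists_dominating_core ht F hab nab
  refine ⟨N + t, fun n hn G hG => lam_le_and_eq_iff fun hlam => ?_⟩
  have hsq : (t : ℝ) * (n - t) ≤ lam (friendshipGraph n t) ^ 2 := by
    refine sq_lam_join_ge (by omega) _ ?_
    simp only [Fintype.card_sum, Fintype.card_prod, Fintype.card_fin]
    omega
  have h0 : 0 ≤ lam (friendshipGraph n t) := by
    have : Nonempty (Fin t) := ⟨⟨0, ht⟩⟩
    exact lam_nonneg _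
  obtain ⟨T, R, hT, hRc, hR, hGH⟩ := hN (Fin n) G (by rw [Fintype.card_fin]; omega) hG
    (by rw [Fintype.card_fin]; exact hsq.trans (pow_le_pow_left₀ h0 hlam 2))
  -- The edges of `G` inside `R`, with the vertices outside `T ∪ R` isolated. This is a matching,
  -- and only these edges have to be present in the target.
  let M : SimpleGraph {v // v ∉ T} := (G.induce (R : Set (Fin n))).spanningCoe.comap Subtype.val
  have hM : ∀ c d : {v // v ∉ T}, M.Adj c d ↔ c.1 ∈ R ∧ d.1 ∈ R ∧ G.Adj c d := by
    intro c d
    simp [M, SimpleGraph.map_adj]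
    tauto
  obtain ⟨e, he⟩ := exists_equiv_edgesAndPoints M (fun u v w huv huw => by
    rw [hM] at huv huw
    exact Subtype.ext (eq_of_adj_of_adj hG hab nab hT (fun w hw => (hR w).1 hw) hRc huv.2.1
      huw.2.1 huv.1 huv.2.2 huw.2.2)) (card_notMem hT)
  exact iso_of_lam_ge _ hT hR hGH e
    (fun c d hc hd hcd => he c d ((hM c d).2 ⟨hc, hd, hcd⟩)) hlam

theorem extremal_splitGraph {t : ℕ} (F : SimpleGraph (Fin (t + 3)))
    {a b c : Fin (t + 3)} (hab : a ≠ b) (hac : a ≠ c) (hbc : b ≠ c) (nab : ¬ F.Adj a b)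
    (nbc : ¬ F.Adj b c) :
    ∃ N : ℕ, ∀ n ≥ N, ∀ G : SimpleGraph (Fin n), MinorFree F G →
      lam G ≤ lam (splitGraph n t) ∧
        (lam G = lam (splitGraph n t) ↔ Nonempty (G ≃g splitGraph n t)) := by
  rcases Nat.eq_zero_or_pos t with rfl | ht
  -- For `t = 0` every vertex is a common neighbour of `T = ∅`, so `G` has no edges as soon as `n ≥
  -- 0 + 4`.
  · refine ⟨4, fun n hn G hG => lam_le_and_eq_iff fun _ => ?_⟩
    have hG' : ∀ u v, ¬ G.Adj u v := fun u v =>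
      not_adj_of_common hG hab hac hbc nab nbc (T := ∅) (R := univ) card_empty (by simp)
        (by simpa using hn) (mem_univ u) (mem_univ v)
    refine ⟨⟨(Equiv.emptySum (Fin 0) (Fin n)).symm, ?_⟩⟩
    intro u v
    refine iff_of_false ?_ (hG' u v)
    rw [Equiv.emptySum_symm_apply, Equiv.emptySum_symm_apply, splitGraph, join_adj_inr_inr]
    exact id
  obtain ⟨N, hN⟩ := exists_dominating_core ht F hab nab
  refine ⟨N + t, fun n hn G hG => lam_le_and_eq_iff fun hlam => ?_⟩
  have hsq : (t : ℝ) * (n - t) ≤ lam (splitGraph n t) ^ 2 :=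
    sq_lam_join_ge (by omega) _ (Fintype.card_fin _)
  have h0 : 0 ≤ lam (splitGraph n t) := by
    have : Nonempty (Fin t) := ⟨⟨0, ht⟩⟩
    exact lam_nonneg _
  obtain ⟨T, R, hT, hRc, hR, hGH⟩ := hN (Fin n) G (by rw [Fintype.card_fin]; omega) hG
    (by rw [Fintype.card_fin]; exact hsq.trans (pow_le_pow_left₀ h0 hlam 2))
  exact iso_of_lam_ge _ hT hR hGH (Fintype.equivFinOfCardEq (card_notMem hT))
    (fun u v hu hv huv => absurd huv (not_adj_of_common hG hab hac hbc nab nbc hT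
      (fun w hw => (hR w).1 hw) hRc hu hv)) hlam

end Extremal

end MinorSpectral

theorem mainTheorem1 (r l : ℕ) (k : Fin l → ℕ) (φ : (Σ i, Fin (k i)) ↪ Fin r) :
    ((4 ≤ r ∧ 1 ≤ l ∧ ∀ i, k i = 2) →
      ∃ N : ℕ, ∀ n ≥ N,
        MinorSpectral.MinorFree (MinorSpectral.completeMinusPaths r k φ)
          (MinorSpectral.friendshipGraph n (r - 3)) ∧
        ∀ G : SimpleGraph (Fin n),
          MinorSpectral.MinorFree (MinorSpectral.completeMinusPaths r k φ) G →
            MinorSpectral.lam G ≤ MinorSpectral.lam (MinorSpectral.friendshipGraph n (r - 3)) ∧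
            (MinorSpectral.lam G = MinorSpectral.lam (MinorSpectral.friendshipGraph n (r - 3)) ↔
              Nonempty (G ≃g MinorSpectral.friendshipGraph n (r - 3)))) ∧
    ((∃ i, 3 ≤ k i) →
      ∃ N : ℕ, ∀ n ≥ N,
        MinorSpectral.MinorFree (MinorSpectral.completeMinusPaths r k φ)
          (MinorSpectral.splitGraph n (r - 3)) ∧
        ∀ G : SimpleGraph (Fin n),
          MinorSpectral.MinorFree (MinorSpectral.completeMinusPaths r k φ) G →
            MinorSpectral.lam G ≤ MinorSpectral.lam (MinorSpectral.splitGraph n (r - 3)) ∧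
            (MinorSpectral.lam G = MinorSpectral.lam (MinorSpectral.splitGraph n (r - 3)) ↔
              Nonempty (G ≃g MinorSpectral.splitGraph n (r - 3)))) := by
  constructor
  · rintro ⟨hr, hl, hk⟩
    obtain ⟨t, rfl⟩ : ∃ t, r = t + 3 := ⟨r - 3, by omega⟩
    rw [Nat.add_sub_cancel]
    obtain ⟨a, b, hab, nab⟩ := MinorSpectral.exists_not_adj (φ := φ) (i := ⟨0, hl⟩) (hk _).ge
    obtain ⟨N, hN⟩ := MinorSpectral.extremal_friendshipGraph (by omega) _ hab nab
    exact ⟨N, fun n hn => ⟨MinorSpectral.minorFree_friendshipGraph fun a b c hab hac hbc =>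
      MinorSpectral.completeMinusPaths_adj_or hk hab hac hbc, hN n hn⟩⟩
  · rintro ⟨i, hi⟩
    have hr : 3 ≤ r := by
      have h := Fintype.card_le_of_injective _
        ((Function.Embedding.sigmaMk (β := fun i => Fin (k i)) i).trans φ).injective
      rw [Fintype.card_fin, Fintype.card_fin] at h
      omega
    obtain ⟨t, rfl⟩ : ∃ t, r = t + 3 := ⟨r - 3, by omega⟩
    rw [Nat.add_sub_cancel]
    obtain ⟨a, b, c, hab, hac, hbc, nab, nbc⟩ := MinorSpectral.exists_not_adj_not_adj (φ := φ) hi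
    obtain ⟨N, hN⟩ := MinorSpectral.extremal_splitGraph _ hab hac hbc nab nbc
    exact ⟨N, fun n hn => ⟨MinorSpectral.minorFree_splitGraph fun a b c hab hac hbc =>
      MinorSpectral.completeMinusPaths_adj_of_three hab hac hbc, hN n hn⟩⟩
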